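/- Let $V$ be a complex vector space with basis $x_1,\dots,x_N$, and let $q\in\mathbb C\setminus\{0,\pm1\}$ be generic, i.e. $k_q:=\frac{q^k-q^{-k}}{q-q^{-1}}\neq 0$ for all integers $k\ne 0$; put $k_q!=1_q2_q\cdots k_q$. An operator $R$ on $V\otimes V$ is written as a matrix, $R(x_i\otimes x_j)=\sum_{k,l} R_{ij}^{kl}\,x_k\otimes x_l$, with lower indices numbering rows and upper indices numbering columns, and all products below are products of matrices; an index such as $k\,k{+}1$ on a matrix indicates the tensor positions in which it acts. Let $R$ be a Hecke symmetry, i.e. $R_{12}R_{23}R_{12}=R_{23}R_{12}R_{23}$ and $(R-qI)(R+q^{-1}I)=0$. Assume that $R$ is even of bi-rank $(m|0)$: the highest nonzero homogeneous component of the algebra $\Lambda_R(V)=T(V)/\langle \mathrm{Im}(q^{-1}I+R)\rangle$ has degree $m$ and is one-dimensional. Assume also that $R$ is skew-invertible: there is a matrix $\Psi$ with $\mathrm{Tr}_{(2)}R_{12}\Psi_{23}=P_{13}=\mathrm{Tr}_{(2)}\Psi_{12}R_{23}$, where $P$ is the flip. Put $C=\mathrm{Tr}_{(2)}\Psi$,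 $\mathrm{Tr}_R X=\mathrm{Tr}(CX)$ for $N\times N$ matrices $X$, and $\mathrm{Tr}_{R(1\dots k)}X=\mathrm{Tr}(C_1\cdots C_k X)$ for $N^k\times N^k$ matrices $X$. Define the skew-symmetrizers by $A^{(1)}=I$ and $$A^{(k)}=\frac1{k_q}A^{(k-1)}\bigl(q^{k-1}I-(k-1)_qR_{k-1\,k}\bigr)A^{(k-1)},\qquad k\ge2 .$$ Let $u=(u_{i_1\dots i_m})$ and $v=(v^{j_1\dots j_m})$ be tensors with $(A^{(m)})_{i_1\dots i_m}^{j_1\dots j_m}=u_{i_1\dots i_m}v^{j_1\dots j_m}$ and $\sum v^{i_1\dots i_m}u_{i_1\dots i_m}=1$. For an $N\times N$ matrix $M$ over a unital associative $\mathbb C$-algebra put $M_{\bar1}=M_1$, $M_{\overline{k+1}}=R_{k\,k+1}M_{\bar k}R_{k\,k+1}^{-1}$, and $$\det\nolimits_{\mathcal L(R,R)}(M)=\sum v^{i_1\dots i_m}(M_{\bar1}\cdots M_{\bar m})_{i_1\dots i_m}^{j_1\dots j_m}u_{j_1\dots j_m}.$$ Let $\mathcal L(R,R)$ be the reflection equation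 algebra: the unital associative $\mathbb C$-algebra generated by the entries of $L=\|l_i^j\|$, with lower index numbering rows, subject to $R_{12}L_{\bar1}L_{\bar2}=L_{\bar1}L_{\bar2}R_{12}$. Put $e_0=1$ and $e_k=\mathrm{Tr}_{R(1\dots k)}A^{(k)}L_{\bar1}\cdots L_{\bar k}$ for $k\ge1$. Then, in the polynomial ring $\mathcal L(R,R)[t]$ in a central indeterminate $t$, $$\det\nolimits_{\mathcal L(R,R)}(L-tI)=\sum_{k=0}^m(-t)^{m-k}\,\alpha_k\,e_k,\qquad \alpha_k=q^{mk}\,\frac{m!}{k!\,(m-k)!}\,\frac{k_q!\,(m-k)_q!}{m_q!}.$$ -/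

import Mathlib

noncomputable section

namespace QuantumDet

/-! Let `V` be a complex vector space with basis `x_1, …, x_N`. An operator on `V ⊗ V` is written as
a matrix `R` with `R (i, j) (k, l) = R_{ij}^{kl}`, `R (x_i ⊗ x_j) = ∑ R_{ij}^{kl} x_k ⊗ x_l`; lower
indices number rows, upper ones number columns. Multi-indices `Fin p → Fin N` number the basis of
`V^{⊗p}`. Positions in `V^{⊗p}` are counted from `0` in the code. -/

/-- Matrices of operators on `V ⊗ V`. -/
abbrev Mat2 (N : ℕ) := Matrix (Fin N × Fin N) (Fin N × Fin N) ℂ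

/-- Matrices of size `N^p × N^p` over `B`. -/
abbrev TMat (N p : ℕ) (B : Type*) := Matrix (Fin p → Fin N) (Fin p → Fin N) B

/-- The quantum integer `k_q = (q^k - q^{-k}) / (q - q^{-1})`. -/
def qInt (q : ℂ) (k : ℤ) : ℂ := (q ^ k - q ^ (-k)) / (q - q⁻¹)

/-- The quantum factorial `k_q! = 1_q 2_q ⋯ k_q`. -/
def qFact (q : ℂ) (k : ℕ) : ℂ := ∏ j ∈ Finset.Icc 1 k, qInt q j

/-- The `N × N` matrix `L` acting in position `a`, the identity in all other positions. -/
def siteOp {N p : ℕ} {B : Type*} [Zero B] (L : Matrix (Fin N) (Fin N) B) (a : Fin p) : TMat N p B :=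
  fun f g => if ∀ c, c ≠ a → f c = g c then L (f a) (g a) else 0

/-- The matrix `M_{ab}`: `M` acting in positions `a ≠ b`, the identity in all other positions. -/
def pairOp {N p : ℕ} (M : Mat2 N) (a b : Fin p) : TMat N p ℂ :=
  fun f g => if ∀ c, c ≠ a → c ≠ b → f c = g c then M (f a, f b) (g a, g b) else 0

/-- The matrix `M ⊗ I`, where `M` acts in the first `k` positions. -/
def extendOne {N k : ℕ} (M : TMat N k ℂ) : TMat N (k + 1) ℂ :=
  fun f g => if f (Fin.last k) = g (Fin.last k) then M (Fin.init f) (Fin.init g) else 0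

/-- The braid relation `R₁₂ R₂₃ R₁₂ = R₂₃ R₁₂ R₂₃`. -/
def IsBraiding {N : ℕ} (R : Mat2 N) : Prop :=
  (pairOp R 0 1 * pairOp R 1 2 * pairOp R 0 1 : TMat N 3 ℂ) =
    pairOp R 1 2 * pairOp R 0 1 * pairOp R 1 2

/-- `R` is a Hecke symmetry with a generic parameter `q`. -/
structure IsHeckeSymmetry {N : ℕ} (R : Mat2 N) (q : ℂ) : Prop where
  braid : IsBraiding R
  hecke : (R - q • (1 : Mat2 N)) * (R + q⁻¹ • (1 : Mat2 N)) = 0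
  q_ne_zero : q ≠ 0
  q_ne_one : q ≠ 1
  q_ne_neg_one : q ≠ -1
  generic : ∀ k : ℤ, k ≠ 0 → qInt q k ≠ 0

/-! ### The `R`-skew-symmetric algebra and even symmetries -/

/-- The relations `(q⁻¹ I + R)(x_i ⊗ x_j) = 0` in the tensor algebra of `V`, which is the free
algebra on the basis. -/
inductive SkewRel {N : ℕ} (R : Mat2 N) (q : ℂ) :
    FreeAlgebra ℂ (Fin N) → FreeAlgebra ℂ (Fin N) → Prop
  | rel (i j : Fin N) : SkewRel R q
      (q⁻¹ • (FreeAlgebra.ι ℂ i * FreeAlgebra.ι ℂ j) +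
        ∑ k, ∑ l, R (i, j) (k, l) • (FreeAlgebra.ι ℂ k * FreeAlgebra.ι ℂ l)) 0

/-- The algebra `Λ_R(V) = T(V) / ⟨Im (q⁻¹ I + R)⟩`. -/
abbrev SkewAlg {N : ℕ} (R : Mat2 N) (q : ℂ) := RingQuot (SkewRel R q)

/-- The homogeneous component `Λ_R^{(k)}(V)`: the image of `V^{⊗k}` in `Λ_R(V)`. -/
def skewComponent {N : ℕ} (R : Mat2 N) (q : ℂ) (k : ℕ) : Submodule ℂ (SkewAlg R q) :=
  Submodule.span ℂ (Set.range fun f : Fin k → Fin N =>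
    (List.ofFn fun a => RingQuot.mkAlgHom ℂ (SkewRel R q) (FreeAlgebra.ι ℂ (f a))).prod)

/-- `R` is even of bi-rank `(m|0)`: the highest nonzero homogeneous component of `Λ_R(V)` is
`Λ_R^{(m)}(V)`, and it is one-dimensional. -/
def IsEven {N : ℕ} (R : Mat2 N) (q : ℂ) (m : ℕ) : Prop :=
  Module.finrank ℂ (skewComponent R q m) = 1 ∧ ∀ k, m < k → skewComponent R q k = ⊥

/-- The skew-symmetrizers: `A^{(1)} = I` and
`A^{(k)} = (1 / k_q) A^{(k-1)} (q^{k-1} I - (k-1)_q R_{k-1,k}) A^{(k-1)}` for `k ≥ 2`. -/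
def skewSymmetrizer {N : ℕ} (R : Mat2 N) (q : ℂ) : (k : ℕ) → TMat N k ℂ
  | 0 => 1
  | 1 => 1
  | k + 2 => (qInt q (k + 2))⁻¹ • (extendOne (skewSymmetrizer R q (k + 1)) *
      (q ^ (k + 1) • (1 : TMat N (k + 2) ℂ) -
        qInt q (k + 1) • pairOp R (Fin.last k).castSucc (Fin.last (k + 1))) *
      extendOne (skewSymmetrizer R q (k + 1)))

/-- The tensors `u = (u_{i_1…i_m})` and `v = (v^{j_1…j_m})` satisfy `A^{(m)} = |u⟩⟨v|` and
`⟨v, u⟩ = 1`. -/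
def IsDetPair {N : ℕ} (R : Mat2 N) (q : ℂ) (m : ℕ) (u v : (Fin m → Fin N) → ℂ) : Prop :=
  (∀ f g, skewSymmetrizer R q m f g = u f * v g) ∧ ∑ f, v f * u f = 1

/-! ### Quantum matrix algebras -/

section Copies

variable {N : ℕ} {B : Type*} [Ring B] [Algebra ℂ B]

/-- The copies `L_{\bar 1} = L_1`, `L_{\overline{k+1}} = F_{k,k+1} L_{\bar k} F_{k,k+1}^{-1}`. -/
def barCopy (F : Mat2 N) (L : Matrix (Fin N) (Fin N) B) (p : ℕ) : (k : ℕ) → k < p → TMat N p B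
  | 0, h => siteOp L ⟨0, h⟩
  | k + 1, h =>
      (pairOp F ⟨k, Nat.lt_of_succ_lt h⟩ ⟨k + 1, h⟩).map (algebraMap ℂ B) *
        barCopy F L p k (Nat.lt_of_succ_lt h) *
        (pairOp F⁻¹ ⟨k, Nat.lt_of_succ_lt h⟩ ⟨k + 1, h⟩).map (algebraMap ℂ B)

/-- The product `L_{\bar 1} L_{\bar 2} ⋯ L_{\bar p}`. -/
def barProd (F : Mat2 N) (L : Matrix (Fin N) (Fin N) B) (p : ℕ) : TMat N p B :=
  (List.ofFn fun k : Fin p => barCopy F L p k k.isLt).prod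

/-- `⟨v| L_{\bar 1} ⋯ L_{\bar m} |u⟩`, the quantum determinant of `L` when `(u, v)` is the pair of
tensors associated with an even symmetry. -/
def qDet (F : Mat2 N) {m : ℕ} (u v : (Fin m → Fin N) → ℂ) (L : Matrix (Fin N) (Fin N) B) : B :=
  ∑ f, ∑ g, (v f * u g) • barProd F L m f g

/-- The trace `Tr_{F(1…k)} X = Tr (C_1 ⋯ C_k X)`, where `C` is the matrix of the `F`-trace
`Tr_F Y = Tr (C Y)`. -/
def multiTrace (C : Matrix (Fin N) (Fin N) ℂ) {k : ℕ} (X : TMat N k B) : B :=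
  ∑ f, ∑ g, (∏ a, C (f a) (g a)) • X g f

/-- The quantum elementary symmetric polynomials `e_0 = 1`,
`e_k = Tr_{F(1…k)} A^{(k)} L_{\bar 1} ⋯ L_{\bar k}`. -/
def elemSym (R F : Mat2 N) (q : ℂ) (C : Matrix (Fin N) (Fin N) ℂ) (L : Matrix (Fin N) (Fin N) B) :
    ℕ → B
  | 0 => 1
  | k + 1 => multiTrace C
      ((skewSymmetrizer R q (k + 1)).map (algebraMap ℂ B) * barProd F L (k + 1))

end Copies

/-- `Ψ` is the skew inverse of `F`: `Tr_(2) F₁₂ Ψ₂₃ = P₁₃ = Tr_(2) Ψ₁₂ F₂₃`. -/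
def IsSkewInverse {N : ℕ} (F Ψ : Mat2 N) : Prop :=
  ∀ i k m n : Fin N,
    (∑ j, ∑ l, F (i, j) (k, l) * Ψ (l, m) (j, n)) = (if m = k ∧ i = n then 1 else 0) ∧
    (∑ j, ∑ l, Ψ (i, j) (k, l) * F (l, m) (j, n)) = (if m = k ∧ i = n then 1 else 0)

/-- The matrix `C = Tr_(2) Ψ`. -/
def traceMatrix {N : ℕ} (Ψ : Mat2 N) : Matrix (Fin N) (Fin N) ℂ :=
  fun i k => ∑ j, Ψ (i, j) (k, j)

/-- The matrix of free generators `l_i^j`. -/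
def freeL (N : ℕ) : Matrix (Fin N) (Fin N) (FreeAlgebra ℂ (Fin N × Fin N)) :=
  fun i j => FreeAlgebra.ι ℂ (i, j)

/-- The defining relations `R₁₂ L_{\bar 1} L_{\bar 2} = L_{\bar 1} L_{\bar 2} R₁₂`, entry by
entry. -/
inductive QMARel {N : ℕ} (R F : Mat2 N) :
    FreeAlgebra ℂ (Fin N × Fin N) → FreeAlgebra ℂ (Fin N × Fin N) → Prop
  | rel (f g : Fin 2 → Fin N) : QMARel R F
      (((pairOp R 0 1).map (algebraMap ℂ (FreeAlgebra ℂ (Fin N × Fin N))) *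
        barProd F (freeL N) 2 : TMat N 2 (FreeAlgebra ℂ (Fin N × Fin N))) f g)
      ((barProd F (freeL N) 2 *
        (pairOp R 0 1).map (algebraMap ℂ (FreeAlgebra ℂ (Fin N × Fin N))) :
          TMat N 2 (FreeAlgebra ℂ (Fin N × Fin N))) f g)

/-- The quantum matrix algebra `𝓛(R, F)`; for `F = R` the reflection equation algebra. -/
abbrev QMA {N : ℕ} (R F : Mat2 N) := RingQuot (QMARel R F)

/-- The generating matrix of `𝓛(R, F)`. -/
def genL {N : ℕ} (R F : Mat2 N) : Matrix (Fin N) (Fin N) (QMA R F) :=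
  fun i j => RingQuot.mkAlgHom ℂ (QMARel R F) (FreeAlgebra.ι ℂ (i, j))

/-- `α_k = q^{mk} (m choose k) k_q! (m-k)_q! / m_q!`. -/
def alphaCoeff (q : ℂ) (m k : ℕ) : ℂ :=
  q ^ (m * k) * (m.choose k : ℂ) * (qFact q k * qFact q (m - k) / qFact q m)

end QuantumDet

end

/-! The determinant is the full trace of `A^{(m)}` against the product of the copies of `L - t`.
Conjugation by `R` fixes central scalars, so the copies of `L - t` are the copies of `L` minus `t`,
and the product can be expanded in powers of `t`.

The point is that a term with `k` factors does not depend on which copies occur. The projector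
`A^{(m)}` satisfies `A R = R A = -q⁻¹ A` for every neighbouring `R`, so under the trace against it
conjugation by `R` is invisible. Since each copy is an `R`-conjugate of the preceding one, and the
`R` involved commutes with the copies already gathered on the left and with the untouched tail on
the right, any copy can be lowered to the first free position (`pairing_shift`). The choices number
`m choose k`, which gives an ordinary binomial expansion whose terms are traces of `A^{(m)}` against
the first `k` copies (`pairing_barProd_sub`).

It remains to compare these ordinary traces with `e_k`. The matrix `C ⊗ C` commutes with `R`
(`IsSkewInverse.commute`), so `C^{⊗m}` commutes with the rank-one projector `A^{(m)}` and acts on it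
as a scalar. The ordinary trace is therefore proportional to the `R`-trace, and tracing out the last
positions lowers `A^{(m)}` to a multiple of `A^{(k)}` (`multiTrace_skewSymmetrizer`). The multiples
depend on `Tr C`. That number is forced to be `q^{-m} m_q`: the partial trace of `A^{(m+1)}` is a
multiple of `A^{(m)} ≠ 0`, while `A^{(m+1)} = 0`, because a representation of `Λ_R(V)` on
functionals exhibits the rows of `A^{(k)}` as values of words of degree `k`
(`skewSymmetrizer_eq_zero`). -/

noncomputable section

namespace QuantumDet

/-! ### Matrices acting in selected tensor positions -/

section Place

variable {N : ℕ} {ι κ μ : Type*} {B : Type*}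

/-- The matrix `M` acting in the positions `e i`, the identity in all other positions. -/
def place [Zero B] (e : ι ↪ κ) (M : Matrix (ι → Fin N) (ι → Fin N) B) :
    Matrix (κ → Fin N) (κ → Fin N) B :=
  open Classical in fun f g =>
    if ∀ c, c ∉ Set.range e → f c = g c then M (f ∘ e) (g ∘ e) else 0

theorem place_apply_of [Zero B] (e : ι ↪ κ) (M : Matrix (ι → Fin N) (ι → Fin N) B)
    {f g : κ → Fin N} (h : ∀ c, c ∉ Set.range e → f c = g c) :
    place e M f g = M (f ∘ e) (g ∘ e) := by
  classical
  exact if_pos h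

theorem place_apply_of_not [Zero B] (e : ι ↪ κ) (M : Matrix (ι → Fin N) (ι → Fin N) B)
    {f g : κ → Fin N} (h : ¬ ∀ c, c ∉ Set.range e → f c = g c) :
    place e M f g = 0 := by
  classical
  exact if_neg h

theorem extend_off (e : ι ↪ κ) (x : ι → Fin N) (f : κ → Fin N) {c : κ} (hc : c ∉ Set.range e) :
    Function.extend e x f c = f c :=
  Function.extend_apply' _ _ _ (by simpa using hc)

theorem extend_comp_self (e : ι ↪ κ) (x : ι → Fin N) (f : κ → Fin N) :
    Function.extend e x f ∘ e = x :=
  Function.extend_comp e.injective x f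

theorem extend_eq_of_off (e : ι ↪ κ) {f h : κ → Fin N}
    (hf : ∀ c, c ∉ Set.range e → f c = h c) : Function.extend e (h ∘ e) f = h := by
  funext c
  by_cases hc : c ∈ Set.range e
  · obtain ⟨i, rfl⟩ := hc
    exact e.injective.extend_apply _ _ _
  · rw [extend_off e _ _ hc, hf c hc]

theorem sum_place [Fintype ι] [DecidableEq ι] [Fintype κ] [DecidableEq κ] [AddCommMonoid B]
    (e : ι ↪ κ) (f : κ → Fin N) (F : (κ → Fin N) → B)
    (hF : ∀ h, (¬ ∀ c, c ∉ Set.range e → f c = h c) → F h = 0) :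
    ∑ h, F h = ∑ x : ι → Fin N, F (Function.extend e x f) := by
  classical
  rw [← Finset.sum_filter_add_sum_filter_not Finset.univ
    (fun h : κ → Fin N => ∀ c, c ∉ Set.range e → f c = h c),
    Finset.sum_eq_zero (s := Finset.univ.filter
      fun h : κ → Fin N => ¬ ∀ c, c ∉ Set.range e → f c = h c)
      (fun h hh => hF h (Finset.mem_filter.1 hh).2), add_zero]
  refine Finset.sum_bij' (fun h _ => h ∘ e) (fun x _ => Function.extend e x f) ?_ ?_ ?_ ?_ ?_
  · simp
  · intro x _
    refine Finset.mem_filter.2 ⟨Finset.mem_univ _, fun c hc => (extend_off e x f hc).symm⟩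
  · intro h hh
    exact extend_eq_of_off e (Finset.mem_filter.1 hh).2
  · intro x _
    exact extend_comp_self e x f
  · intro h hh
    rw [extend_eq_of_off e (Finset.mem_filter.1 hh).2]

theorem place_mul [Fintype ι] [DecidableEq ι] [Fintype κ] [DecidableEq κ]
    [NonUnitalNonAssocSemiring B] (e : ι ↪ κ) (M M' : Matrix (ι → Fin N) (ι → Fin N) B) :
    place e (M * M') = place e M * place e M' := by
  ext f g
  rw [Matrix.mul_apply, sum_place e f _ fun h hh => by rw [place_apply_of_not e M hh, zero_mul]]
  by_cases hfg : ∀ c, c ∉ Set.range e → f c = g c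
  · rw [place_apply_of e _ hfg, Matrix.mul_apply]
    refine Finset.sum_congr rfl fun x _ => ?_
    rw [place_apply_of e _ fun c hc => (extend_off e x f hc).symm,
      place_apply_of e _ fun c hc => (extend_off e x f hc).trans (hfg c hc), extend_comp_self]
  · rw [place_apply_of_not e _ hfg]
    refine (Finset.sum_eq_zero fun x _ => ?_).symm
    rw [place_apply_of_not e M', mul_zero]
    exact fun H => hfg fun c hc => (extend_off e x f hc).symm.trans (H c hc)

theorem place_one [Fintype ι] [DecidableEq ι] [Fintype κ] [DecidableEq κ] [Zero B] [One B] (e : ι ↪ κ) :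
    place e (1 : Matrix (ι → Fin N) (ι → Fin N) B) =
      (1 : Matrix (κ → Fin N) (κ → Fin N) B) := by
  classical
  ext f g
  by_cases hfg : ∀ c, c ∉ Set.range e → f c = g c
  · rw [place_apply_of e _ hfg, Matrix.one_apply, Matrix.one_apply]
    refine if_congr ⟨fun h => ?_, fun h => by rw [h]⟩ rfl rfl
    funext c
    by_cases hc : c ∈ Set.range e
    · obtain ⟨i, rfl⟩ := hc
      exact congrFun h i
    · exact hfg c hc
  · rw [place_apply_of_not e _ hfg, Matrix.one_apply_ne fun h => hfg fun c _ => by rw [h]]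

theorem place_add [AddZeroClass B] (e : ι ↪ κ) (M M' : Matrix (ι → Fin N) (ι → Fin N) B) :
    place e (M + M') = place e M + place e M' := by
  ext f g
  by_cases hfg : ∀ c, c ∉ Set.range e → f c = g c
  · simp only [Matrix.add_apply, place_apply_of e _ hfg]
  · simp only [Matrix.add_apply, place_apply_of_not e _ hfg, add_zero]

theorem place_smul {S : Type*} [Zero B] [SMulZeroClass S B] (s : S) (e : ι ↪ κ)
    (M : Matrix (ι → Fin N) (ι → Fin N) B) : place e (s • M) = s • place e M := by
  ext f g
  by_cases hfg : ∀ c, c ∉ Set.range e → f c = g c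
  · simp only [Matrix.smul_apply, place_apply_of e _ hfg]
  · simp only [Matrix.smul_apply, place_apply_of_not e _ hfg, smul_zero]

theorem place_map {B' : Type*} [Zero B] [Zero B'] (φ : B → B') (hφ : φ 0 = 0) (e : ι ↪ κ)
    (M : Matrix (ι → Fin N) (ι → Fin N) B) : place e (M.map φ) = (place e M).map φ := by
  ext f g
  by_cases hfg : ∀ c, c ∉ Set.range e → f c = g c
  · simp only [Matrix.map_apply, place_apply_of e _ hfg]
  · simp only [Matrix.map_apply, place_apply_of_not e _ hfg, hφ]

theorem place_place [Zero B] (e : ι ↪ κ) (e' : κ ↪ μ) (M : Matrix (ι → Fin N) (ι → Fin N) B) :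
    place e' (place e M) = place (e.trans e') M := by
  ext f g
  by_cases h : ∀ c, c ∉ Set.range (e.trans e') → f c = g c
  · rw [place_apply_of _ _ h, place_apply_of e', place_apply_of e]
    · rfl
    · intro c hc
      refine h _ ?_
      rintro ⟨i, hi⟩
      exact hc ⟨i, e'.injective hi⟩
    · intro c hc
      refine h _ ?_
      rintro ⟨i, hi⟩
      exact hc ⟨e i, hi⟩
  · rw [place_apply_of_not _ _ h]
    by_cases h' : ∀ c, c ∉ Set.range e' → f c = g c
    · rw [place_apply_of _ _ h', place_apply_of_not]
      intro H
      refine h fun c hc => ?_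
      by_cases hc' : c ∈ Set.range e'
      · obtain ⟨d, rfl⟩ := hc'
        refine H d ?_
        rintro ⟨i, rfl⟩
        exact hc ⟨i, rfl⟩
      · exact h' c hc'
    · rw [place_apply_of_not _ _ h']

variable {ι' : Type*}

theorem place_mul_place_apply [Fintype κ] [DecidableEq κ] [NonUnitalNonAssocSemiring B]
    (e : ι ↪ κ) (e' : ι' ↪ κ) (hd : Disjoint (Set.range e) (Set.range e'))
    (M : Matrix (ι → Fin N) (ι → Fin N) B) (M' : Matrix (ι' → Fin N) (ι' → Fin N) B)
    {f g : κ → Fin N} (h : ∀ c, c ∉ Set.range e → c ∉ Set.range e' → f c = g c) :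
    (place e M * place e' M') f g = M (f ∘ e) (g ∘ e) * M' (f ∘ e') (g ∘ e') := by
  have hoff : ∀ i, e' i ∉ Set.range e := fun i hi =>
    Set.disjoint_left.1 hd hi ⟨i, rfl⟩
  have hoff' : ∀ i, e i ∉ Set.range e' := fun i hi =>
    Set.disjoint_left.1 hd ⟨i, rfl⟩ hi
  rw [Matrix.mul_apply, Finset.sum_eq_single (Function.extend e (g ∘ e) f)]
  · rw [place_apply_of e _ fun c hc => (extend_off e _ f hc).symm, extend_comp_self,
      place_apply_of e']
    · congr 2
      funext i
      exact extend_off e _ f (hoff i)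
    · intro c hc
      by_cases hc' : c ∈ Set.range e
      · obtain ⟨i, rfl⟩ := hc'
        exact e.injective.extend_apply _ _ _
      · rw [extend_off e _ f hc', h c hc' hc]
  · intro x _ hx
    by_cases h1 : ∀ c, c ∉ Set.range e → f c = x c
    · rw [place_apply_of_not e' M', mul_zero]
      intro H
      refine hx ?_
      rw [← extend_eq_of_off e h1]
      congr 1
      funext i
      exact H _ (hoff' i)
    · rw [place_apply_of_not e M h1, zero_mul]
  · simp

theorem place_mul_place_apply_of_not [Fintype κ] [DecidableEq κ] [NonUnitalNonAssocSemiring B]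
    (e : ι ↪ κ) (e' : ι' ↪ κ)
    (M : Matrix (ι → Fin N) (ι → Fin N) B) (M' : Matrix (ι' → Fin N) (ι' → Fin N) B)
    {f g : κ → Fin N} (h : ¬ ∀ c, c ∉ Set.range e → c ∉ Set.range e' → f c = g c) :
    (place e M * place e' M') f g = 0 := by
  rw [Matrix.mul_apply]
  refine Finset.sum_eq_zero fun x _ => ?_
  by_cases h1 : ∀ c, c ∉ Set.range e → f c = x c
  · rw [place_apply_of_not e' M', mul_zero]
    exact fun H => h fun c hc hc' => (h1 c hc).trans (H c hc')
  · rw [place_apply_of_not e M h1, zero_mul]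

/-- With disjoint supports each entry of the product is a single product of two entries, so over a
noncommutative ring only the commutation of entries remains to be assumed. -/
theorem commute_place [Fintype κ] [DecidableEq κ] [NonUnitalNonAssocSemiring B]
    (e : ι ↪ κ) (e' : ι' ↪ κ) (hd : Disjoint (Set.range e) (Set.range e'))
    (M : Matrix (ι → Fin N) (ι → Fin N) B) (M' : Matrix (ι' → Fin N) (ι' → Fin N) B)
    (hM : ∀ f g f' g', Commute (M f g) (M' f' g')) :
    Commute (place e M) (place e' M') := by
  ext f g
  by_cases h : ∀ c, c ∉ Set.range e → c ∉ Set.range e' → f c = g c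
  · rw [place_mul_place_apply e e' hd M M' h,
      place_mul_place_apply e' e hd.symm M' M fun c h1 h2 => h c h2 h1]
    exact hM _ _ _ _
  · rw [place_mul_place_apply_of_not e e' M M' h,
      place_mul_place_apply_of_not e' e M' M fun H => h fun c h1 h2 => H c h2 h1]

end Place

/-! ### One- and two-site operators -/

section Ops

variable {N k p : ℕ} {B : Type*}

theorem extendOne_eq_place (M : TMat N k ℂ) : extendOne M = place Fin.castSuccEmb M := by
  ext f g
  by_cases h : f (Fin.last k) = g (Fin.last k)
  · rw [place_apply_of]
    · exact if_pos h
    · intro c hc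
      induction c using Fin.lastCases with
      | last => exact h
      | cast i => exact absurd ⟨i, rfl⟩ hc
  · rw [place_apply_of_not]
    · exact if_neg h
    · intro H
      refine h (H _ ?_)
      rintro ⟨i, hi⟩
      exact (Fin.castSucc_lt_last i).ne hi

theorem place_pairOp (e : Fin k ↪ Fin p) (M : Mat2 N) (a b : Fin k) :
    place e (pairOp M a b) = pairOp M (e a) (e b) := by
  ext f g
  by_cases h : ∀ c, c ≠ e a → c ≠ e b → f c = g c
  · rw [place_apply_of]
    · unfold pairOp
      rw [if_pos h, if_pos]
      · rfl
      · exact fun c h1 h2 => h _ (e.injective.ne h1) (e.injective.ne h2)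
    · intro c hc
      refine h c ?_ ?_ <;> rintro rfl <;> exact hc ⟨_, rfl⟩
  · have : pairOp M (e a) (e b) f g = 0 := if_neg h
    rw [this]
    by_cases h' : ∀ c, c ∉ Set.range e → f c = g c
    · rw [place_apply_of _ _ h']
      refine if_neg fun H => h fun c h1 h2 => ?_
      by_cases hc : c ∈ Set.range e
      · obtain ⟨i, rfl⟩ := hc
        exact H i (fun h => h1 (h ▸ rfl)) (fun h => h2 (h ▸ rfl))
      · exact h' c hc
    · exact place_apply_of_not _ _ h'

theorem place_siteOp [Zero B] (e : Fin k ↪ Fin p) (M : Matrix (Fin N) (Fin N) B) (a : Fin k) :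
    place e (siteOp M a) = siteOp M (e a) := by
  ext f g
  by_cases h : ∀ c, c ≠ e a → f c = g c
  · rw [place_apply_of]
    · unfold siteOp
      rw [if_pos h, if_pos]
      · rfl
      · exact fun c h1 => h _ (e.injective.ne h1)
    · intro c hc
      refine h c ?_
      rintro rfl
      exact hc ⟨_, rfl⟩
  · have : siteOp M (e a) f g = 0 := if_neg h
    rw [this]
    by_cases h' : ∀ c, c ∉ Set.range e → f c = g c
    · rw [place_apply_of _ _ h']
      refine if_neg fun H => h fun c h1 => ?_
      by_cases hc : c ∈ Set.range e
      · obtain ⟨i, rfl⟩ := hc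
        exact H i (fun h => h1 (h ▸ rfl))
      · exact h' c hc
    · exact place_apply_of_not _ _ h'

/-- The embedding of two positions. -/
def pairEmb {a b : Fin p} (h : a ≠ b) : Fin 2 ↪ Fin p :=
  ⟨![a, b], by
    intro i j hij
    fin_cases i <;> fin_cases j <;> simp_all [eq_comm]⟩

/-- The embedding of one position. -/
def siteEmb (a : Fin p) : Fin 1 ↪ Fin p := ⟨fun _ => a, fun i j _ => Subsingleton.elim i j⟩

theorem range_pairEmb {a b : Fin p} (h : a ≠ b) : Set.range (pairEmb h) = {a, b} := by
  ext c
  rw [Set.mem_range, Fin.exists_fin_two]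
  exact or_congr eq_comm eq_comm

theorem range_siteEmb (a : Fin p) : Set.range (siteEmb a) = {a} := by
  ext c
  rw [Set.mem_range, Fin.exists_fin_one]
  exact eq_comm

theorem range_castSuccEmb : Set.range (Fin.castSuccEmb : Fin k ↪ Fin (k + 1)) = {Fin.last k}ᶜ := by
  ext c
  induction c using Fin.lastCases with
  | last => simp
  | cast i => simp [(Fin.castSucc_lt_last _).ne]

theorem pairOp_eq_place (M : Mat2 N) {a b : Fin p} (h : a ≠ b) :
    pairOp M a b = place (pairEmb h) (pairOp M 0 1) :=
  (place_pairOp (pairEmb h) M 0 1).symm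

theorem siteOp_eq_place [Zero B] (M : Matrix (Fin N) (Fin N) B) (a : Fin p) :
    siteOp M a = place (siteEmb a) (siteOp M 0) :=
  (place_siteOp (siteEmb a) M 0).symm

theorem pairOp_two (M : Mat2 N) :
    (pairOp M 0 1 : TMat N 2 ℂ) = M.submatrix (finTwoArrowEquiv (Fin N)) (finTwoArrowEquiv _) := by
  ext f g
  refine if_pos fun c h0 h1 => ?_
  fin_cases c
  · exact absurd rfl h0
  · exact absurd rfl h1

theorem pairOp_mul (M M' : Mat2 N) {a b : Fin p} (h : a ≠ b) :
    pairOp (M * M') a b = pairOp M a b * pairOp M' a b := by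
  rw [pairOp_eq_place _ h, pairOp_eq_place M h, pairOp_eq_place M' h, ← place_mul, pairOp_two,
    pairOp_two, pairOp_two, Matrix.submatrix_mul_equiv]

theorem pairOp_one {a b : Fin p} (h : a ≠ b) : pairOp (1 : Mat2 N) a b = 1 := by
  rw [pairOp_eq_place _ h, pairOp_two, Matrix.submatrix_one_equiv, place_one]

theorem pairOp_add (M M' : Mat2 N) (a b : Fin p) :
    pairOp (M + M') a b = pairOp M a b + pairOp M' a b := by
  ext f g
  simp only [pairOp, Matrix.add_apply]
  split_ifs <;> simp

theorem pairOp_smul (s : ℂ) (M : Mat2 N) (a b : Fin p) :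
    pairOp (s • M) a b = s • pairOp M a b := by
  ext f g
  simp only [pairOp, Matrix.smul_apply]
  split_ifs <;> simp

theorem commute_pairOp_place (M : Mat2 N) {a b : Fin p} (hab : a ≠ b) {ι : Type*}
    [Ring B] [Algebra ℂ B] (e : ι ↪ Fin p) (ha : a ∉ Set.range e) (hb : b ∉ Set.range e)
    (X : Matrix (ι → Fin N) (ι → Fin N) B) :
    Commute ((pairOp M a b).map (algebraMap ℂ B)) (place e X) := by
  rw [pairOp_eq_place _ hab, ← place_map _ (map_zero _)]
  refine commute_place _ _ ?_ _ _ fun f g f' g' => Algebra.commutes _ _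
  rw [range_pairEmb, Set.disjoint_left]
  rintro c (rfl | rfl) <;> assumption

theorem map_algebraMap_mul [Ring B] [Algebra ℂ B] (X Y : TMat N p ℂ) :
    (X * Y).map (algebraMap ℂ B) = X.map (algebraMap ℂ B) * Y.map (algebraMap ℂ B) :=
  Matrix.map_mul

theorem map_algebraMap_self (X : TMat N p ℂ) : X.map (algebraMap ℂ ℂ) = X := by
  ext; rfl

theorem braid_pairOp {R : Mat2 N} (hR : IsBraiding R) {a b c : Fin p} (hab : a ≠ b) (hac : a ≠ c)
    (hbc : b ≠ c) :
    pairOp R a b * pairOp R b c * pairOp R a b = pairOp R b c * pairOp R a b * pairOp R b c := by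
  let e : Fin 3 ↪ Fin p := ⟨![a, b, c], by
    intro i j hij
    fin_cases i <;> fin_cases j <;> simp_all [eq_comm]⟩
  have h1 : pairOp R a b = place e (pairOp R 0 1) := (place_pairOp e R 0 1).symm
  have h2 : pairOp R b c = place e (pairOp R 1 2) := (place_pairOp e R 1 2).symm
  have h := hR
  unfold IsBraiding at h
  rw [h1, h2, ← place_mul, ← place_mul, h, place_mul, place_mul]

end Ops

/-! ### Quantum integers -/

section QInt

theorem qInt_zero (q : ℂ) : qInt q 0 = 0 := by simp [qInt]

theorem qInt_one {q : ℂ} (hq : q - q⁻¹ ≠ 0) : qInt q 1 = 1 := by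
  simp [qInt, div_self hq]

theorem qInt_succ {q : ℂ} (hq0 : q ≠ 0) (hq : q - q⁻¹ ≠ 0) (k : ℕ) :
    qInt q ((k + 1 : ℕ) : ℤ) = q ^ k + q⁻¹ * qInt q (k : ℤ) := by
  unfold qInt
  rw [zpow_natCast, zpow_neg, zpow_natCast, zpow_natCast, zpow_neg, zpow_natCast,
    ← mul_div_assoc, ← sub_eq_iff_eq_add, ← sub_div, div_eq_iff hq]
  field_simp
  ring

theorem qInt_sub_left {q : ℂ} (hq0 : q ≠ 0) {m k : ℕ} (hk : k ≤ m) :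
    q ^ k * ((q ^ m)⁻¹ * qInt q (m : ℤ)) - qInt q (k : ℤ) =
      (q ^ m)⁻¹ * qInt q ((m - k : ℕ) : ℤ) := by
  obtain ⟨d, rfl⟩ := Nat.exists_eq_add_of_le hk
  rw [Nat.add_sub_cancel_left]
  unfold qInt
  simp only [zpow_natCast, zpow_neg, ← mul_div_assoc]
  rw [← sub_div]
  congr 1
  field_simp
  ring

variable {N : ℕ} {R : Mat2 N} {q : ℂ}

theorem IsHeckeSymmetry.sub_inv_ne_zero (hR : IsHeckeSymmetry R q) : q - q⁻¹ ≠ 0 := by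
  intro h
  have h0 := hR.q_ne_zero
  have h1 : (q - 1) * (q + 1) = 0 := by
    field_simp at h
    linear_combination h
  rcases mul_eq_zero.1 h1 with h | h
  · exact hR.q_ne_one (sub_eq_zero.1 h)
  · exact hR.q_ne_neg_one (eq_neg_of_add_eq_zero_left h)

theorem IsHeckeSymmetry.qInt_ne_zero (hR : IsHeckeSymmetry R q) {k : ℕ} (hk : k ≠ 0) :
    qInt q (k : ℤ) ≠ 0 :=
  hR.generic _ (by exact_mod_cast hk)

end QInt

/-! ### The Hecke algebra computation behind the skew-symmetrizers -/

section HeckeAlgebra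

variable {𝒜 : Type*} [Ring 𝒜] [Algebra ℂ 𝒜] {s r a b : 𝒜} {q c n n' : ℂ}

/-- In the application `a` and `b` are two consecutive skew-symmetrizers, `r` is the last `R` inside
`b` and `s` is the next one. Expanding one `b` in `b s b` by its recursion, and moving `s` through
`a`, writes the product as a combination of `(s - q) b` and `a r s b`. The factor `s + q⁻¹` kills
the first by the Hecke relation and the second because `s r s b = r s r b = -q⁻¹ r s b`. -/
theorem hecke_step_left (hb : n • b = a * (c • 1 - n' • r) * a) (hab : a * b = b)
    (hbb : b * b = b) (hsa : Commute s a) (hbr : s * r * s = r * s * r) (hrb : r * b = -q⁻¹ • b)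
    (hs : (s + q⁻¹ • 1) * (s - q • 1) = 0) :
    (s + q⁻¹ • 1) * (b * ((c * q) • 1 - n • s) * b) = 0 := by
  have h1 : n • (b * s * b) = c • (s * b) - n' • (a * (r * s * b)) := by
    calc n • (b * s * b) = (n • b) * (s * b) := by rw [smul_mul_assoc, mul_assoc]
      _ = a * (c • 1 - n' • r) * ((a * s) * b) := by rw [hb]; noncomm_ring
      _ = a * (c • 1 - n' • r) * (s * b) := by rw [← hsa.eq, mul_assoc s, hab]
      _ = c • (a * s * b) - n' • (a * (r * s * b)) := by
        simp only [mul_sub, sub_mul, mul_smul_comm, smul_mul_assoc, mul_one, mul_assoc]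
      _ = _ := by rw [← hsa.eq, mul_assoc s, hab]
  have h2 : b * ((c * q) • 1 - n • s) * b = -c • ((s - q • 1) * b) + n' • (a * (r * s * b)) := by
    have : b * ((c * q) • 1 - n • s) * b = (c * q) • (b * b) - n • (b * s * b) := by
      simp only [mul_sub, sub_mul, mul_smul_comm, smul_mul_assoc, mul_one]
    rw [this, h1, hbb, sub_mul, smul_mul_assoc, one_mul]
    module
  have h3 : (s + q⁻¹ • 1) * (a * (r * s * b)) = 0 := by
    have : Commute (s + q⁻¹ • 1) a := hsa.add_left ((Commute.one_left a).smul_left _)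
    rw [← mul_assoc, this.eq, mul_assoc, add_mul, smul_mul_assoc, one_mul]
    have : s * (r * s * b) = r * s * (r * b) := by
      rw [← mul_assoc, ← mul_assoc, hbr, mul_assoc]
    rw [this, hrb, mul_smul_comm, neg_smul, neg_add_cancel, mul_zero]
  rw [h2, mul_add, mul_smul_comm, mul_smul_comm, h3, ← mul_assoc, hs]
  simp

theorem hecke_step_right (hb : n • b = a * (c • 1 - n' • r) * a) (hba : b * a = b)
    (hbb : b * b = b) (hsa : Commute s a) (hbr : s * r * s = r * s * r) (hrb : b * r = -q⁻¹ • b)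
    (hs : (s - q • 1) * (s + q⁻¹ • 1) = 0) :
    (b * ((c * q) • 1 - n • s) * b) * (s + q⁻¹ • 1) = 0 := by
  have h1 : n • (b * s * b) = c • (b * s) - n' • ((b * s * r) * a) := by
    calc n • (b * s * b) = (b * s) * (n • b) := by rw [mul_smul_comm]
      _ = (b * (s * a)) * (c • 1 - n' • r) * a := by rw [hb]; noncomm_ring
      _ = b * s * (c • 1 - n' • r) * a := by rw [hsa.eq, ← mul_assoc b, hba]
      _ = c • (b * (s * a)) - n' • ((b * s * r) * a) := by
        simp only [mul_sub, sub_mul, mul_smul_comm, smul_mul_assoc, mul_one, mul_assoc]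
      _ = _ := by rw [hsa.eq, ← mul_assoc b, hba]
  have h2 : b * ((c * q) • 1 - n • s) * b = -c • (b * (s - q • 1)) + n' • ((b * s * r) * a) := by
    have : b * ((c * q) • 1 - n • s) * b = (c * q) • (b * b) - n • (b * s * b) := by
      simp only [mul_sub, sub_mul, mul_smul_comm, smul_mul_assoc, mul_one]
    rw [this, h1, hbb, mul_sub, mul_smul_comm, mul_one]
    module
  have h3 : ((b * s * r) * a) * (s + q⁻¹ • 1) = 0 := by
    have : Commute (s + q⁻¹ • 1) a := hsa.add_left ((Commute.one_left a).smul_left _)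
    rw [mul_assoc, ← this.eq, ← mul_assoc, mul_add, mul_smul_comm, mul_one]
    have : b * s * r * s = (b * r) * s * r := by
      rw [mul_assoc, mul_assoc, ← mul_assoc s, hbr]; noncomm_ring
    rw [this, hrb, smul_mul_assoc, smul_mul_assoc, neg_smul, neg_add_cancel, zero_mul]
  rw [h2, add_mul, smul_mul_assoc, smul_mul_assoc, h3, mul_assoc, hs]
  simp

end HeckeAlgebra

/-! ### Skew-symmetrizers as projectors absorbing every neighbouring `R` -/

section SkewSymmetrizer

variable {N : ℕ}

/-- `M` acting in the positions `k, k + 1`. -/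
def adjOp (M : Mat2 N) (p k : ℕ) (h : k + 1 < p) : TMat N p ℂ :=
  pairOp M ⟨k, Nat.lt_of_succ_lt h⟩ ⟨k + 1, h⟩

theorem adj_ne {p k : ℕ} (h : k + 1 < p) :
    (⟨k, Nat.lt_of_succ_lt h⟩ : Fin p) ≠ ⟨k + 1, h⟩ := by
  simp [Fin.ext_iff]

theorem extendOne_mul {k : ℕ} (X Y : TMat N k ℂ) :
    extendOne (X * Y) = extendOne X * extendOne Y := by
  simp only [extendOne_eq_place, place_mul]

theorem extendOne_one {k : ℕ} : extendOne (1 : TMat N k ℂ) = 1 := by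
  rw [extendOne_eq_place, place_one]

theorem extendOne_smul {k : ℕ} (s : ℂ) (X : TMat N k ℂ) :
    extendOne (s • X) = s • extendOne X := by
  simp only [extendOne_eq_place, place_smul]

theorem extendOne_sub {k : ℕ} (X Y : TMat N k ℂ) :
    extendOne (X - Y) = extendOne X - extendOne Y := by
  rw [sub_eq_add_neg, sub_eq_add_neg, ← neg_one_smul ℂ Y, extendOne_eq_place, place_add,
    place_smul, neg_one_smul, extendOne_eq_place, extendOne_eq_place]

theorem extendOne_adjOp (M : Mat2 N) {p k : ℕ} (h : k + 1 < p) :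
    extendOne (adjOp M p k h) = adjOp M (p + 1) k (Nat.lt_succ_of_lt h) := by
  rw [extendOne_eq_place]
  exact place_pairOp _ _ _ _

theorem commute_adjOp_extendOne_extendOne (M : Mat2 N) {k : ℕ} (X : TMat N k ℂ) :
    Commute (adjOp M (k + 2) k (Nat.lt_succ_self _)) (extendOne (extendOne X)) := by
  rw [extendOne_eq_place, extendOne_eq_place, place_place, ← map_algebraMap_self (adjOp _ _ _ _)]
  have : ∀ c : Fin (k + 2), k ≤ c.val →
      c ∉ Set.range (Fin.castSuccEmb.trans Fin.castSuccEmb : Fin k ↪ Fin (k + 2)) := by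
    rintro c hc ⟨i, rfl⟩
    exact absurd hc (by simp)
  exact commute_pairOp_place M (adj_ne _) _ (this _ le_rfl) (this _ (Nat.le_succ k)) X

theorem skewSymmetrizer_succ_succ (R : Mat2 N) (q : ℂ) (k : ℕ) :
    skewSymmetrizer R q (k + 2) = (qInt q ((k + 2 : ℕ) : ℤ))⁻¹ •
      (extendOne (skewSymmetrizer R q (k + 1)) *
        (q ^ (k + 1) • (1 : TMat N (k + 2) ℂ) -
          qInt q ((k + 1 : ℕ) : ℤ) • adjOp R (k + 2) k (Nat.lt_succ_self _)) *
      extendOne (skewSymmetrizer R q (k + 1))) := by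
  rw [skewSymmetrizer]
  push_cast
  rfl

variable {R : Mat2 N} {q : ℂ}

theorem IsHeckeSymmetry.adjOp_mul (hR : IsHeckeSymmetry R q) {p k : ℕ} (h : k + 1 < p) :
    (adjOp R p k h - q • 1) * (adjOp R p k h + q⁻¹ • 1) = 0 := by
  have := congrArg (fun M => pairOp M ⟨k, Nat.lt_of_succ_lt h⟩ ⟨k + 1, h⟩) hR.hecke
  simp only [sub_eq_add_neg, ← neg_smul] at this ⊢
  rw [pairOp_mul _ _ (adj_ne h), pairOp_add, pairOp_add, pairOp_smul, pairOp_smul,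
    pairOp_one (adj_ne h)] at this
  refine this.trans ?_
  ext f g
  simp [pairOp]

theorem IsHeckeSymmetry.adjOp_mul' (hR : IsHeckeSymmetry R q) {p k : ℕ} (h : k + 1 < p) :
    (adjOp R p k h + q⁻¹ • 1) * (adjOp R p k h - q • 1) = 0 := by
  rw [← hR.adjOp_mul h]
  simp only [mul_add, add_mul, mul_sub, sub_mul, mul_smul_comm, smul_mul_assoc, mul_one, one_mul]
  module

theorem braid_adjOp (hR : IsBraiding R) {p k : ℕ} (h : k + 2 < p) :
    adjOp R p (k + 1) h * adjOp R p k (Nat.lt_of_succ_lt h) * adjOp R p (k + 1) h =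
      adjOp R p k (Nat.lt_of_succ_lt h) * adjOp R p (k + 1) h *
        adjOp R p k (Nat.lt_of_succ_lt h) :=
  (braid_pairOp hR (by simp [Fin.ext_iff]) (by simp [Fin.ext_iff]; omega) (by simp [Fin.ext_iff])).symm

/-- The characteristic properties of the skew-symmetrizer `A^{(k+1)}`. -/
structure SkewSymmetrizerProps (R : Mat2 N) (q : ℂ) (k : ℕ) : Prop where
  left : ∀ j (h : j + 1 < k + 1), adjOp R (k + 1) j h * skewSymmetrizer R q (k + 1) =
    -q⁻¹ • skewSymmetrizer R q (k + 1)
  right : ∀ j (h : j + 1 < k + 1), skewSymmetrizer R q (k + 1) * adjOp R (k + 1) j h =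
    -q⁻¹ • skewSymmetrizer R q (k + 1)
  idem : skewSymmetrizer R q (k + 1) * skewSymmetrizer R q (k + 1) = skewSymmetrizer R q (k + 1)
  extendOne_mul : extendOne (skewSymmetrizer R q k) * skewSymmetrizer R q (k + 1) =
    skewSymmetrizer R q (k + 1)
  mul_extendOne : skewSymmetrizer R q (k + 1) * extendOne (skewSymmetrizer R q k) =
    skewSymmetrizer R q (k + 1)

theorem eq_smul_of_add_smul_mul {𝒜 : Type*} [Ring 𝒜] [Algebra ℂ 𝒜] {s x : 𝒜} {c : ℂ}
    (h : (s + c • 1) * x = 0) : s * x = -c • x := by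
  rw [add_mul, smul_mul_assoc, one_mul] at h
  rw [neg_smul, eq_neg_of_add_eq_zero_left h]

theorem eq_smul_of_mul_add_smul {𝒜 : Type*} [Ring 𝒜] [Algebra ℂ 𝒜] {s x : 𝒜} {c : ℂ}
    (h : x * (s + c • 1) = 0) : x * s = -c • x := by
  rw [mul_add, mul_smul_comm, mul_one] at h
  rw [neg_smul, eq_neg_of_add_eq_zero_left h]

/-- All properties are proved in one induction, since each step uses absorption, idempotency and
nesting of the previous projector. Only the last `R` needs the Hecke algebra computation; the
earlier ones are absorbed by the inner projector. -/
theorem IsHeckeSymmetry.skewSymmetrizerProps (hR : IsHeckeSymmetry R q) (k : ℕ) :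
    SkewSymmetrizerProps R q k := by
  have hq0 := hR.q_ne_zero
  have hq := hR.sub_inv_ne_zero
  induction k with
  | zero =>
    refine ⟨fun j h => absurd h (by omega), fun j h => absurd h (by omega), ?_, ?_, ?_⟩ <;>
    simp [skewSymmetrizer, extendOne_one]
  | succ n ih =>
    set b := extendOne (skewSymmetrizer R q (n + 1)) with hbdef
    set s := adjOp R (n + 2) n (Nat.lt_succ_self _) with hsdef
    have hbb : b * b = b := by rw [hbdef, ← QuantumDet.extendOne_mul, ih.idem]
    have hA : skewSymmetrizer R q (n + 2) = (qInt q ((n + 2 : ℕ) : ℤ))⁻¹ •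
      (b * (q ^ (n + 1) • 1 - qInt q ((n + 1 : ℕ) : ℤ) • s) * b) :=
      skewSymmetrizer_succ_succ R q n
    have hbA : b * skewSymmetrizer R q (n + 2) = skewSymmetrizer R q (n + 2) := by
      rw [hA, mul_smul_comm, ← mul_assoc, ← mul_assoc, hbb]
    have hAb : skewSymmetrizer R q (n + 2) * b = skewSymmetrizer R q (n + 2) := by
      rw [hA, smul_mul_assoc, mul_assoc, hbb]
    have key : s * skewSymmetrizer R q (n + 2) = -q⁻¹ • skewSymmetrizer R q (n + 2) ∧
        skewSymmetrizer R q (n + 2) * s = -q⁻¹ • skewSymmetrizer R q (n + 2) := by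
      suffices h : (s + q⁻¹ • 1) * (b * (q ^ (n + 1) • 1 - qInt q ((n + 1 : ℕ) : ℤ) • s) * b) = 0 ∧
          (b * (q ^ (n + 1) • 1 - qInt q ((n + 1 : ℕ) : ℤ) • s) * b) * (s + q⁻¹ • 1) = 0 by
        refine ⟨eq_smul_of_add_smul_mul ?_, eq_smul_of_mul_add_smul ?_⟩
        · rw [hA, mul_smul_comm, h.1, smul_zero]
        · rw [hA, smul_mul_assoc, h.2, smul_zero]
      -- For two positions there is no neighbouring `r` to braid with; there `A^{(2)}` is a multiple
      -- of `s - q`, and the Hecke relation alone suffices.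
      rcases n with _ | n
      · have hb1 : b = 1 := by rw [hbdef]; simp [skewSymmetrizer, extendOne_one]
        have h1 := hR.adjOp_mul (p := 2) (k := 0) (Nat.lt_succ_self _)
        have h2 := hR.adjOp_mul' (p := 2) (k := 0) (Nat.lt_succ_self _)
        have e : q ^ (0 + 1) • (1 : TMat N (0 + 2) ℂ) - qInt q ((0 + 1 : ℕ) : ℤ) • s =
            (-1 : ℂ) • (s - q • 1) := by
          have : qInt q ((0 + 1 : ℕ) : ℤ) = 1 := by simpa using qInt_one hq
          rw [this, show q ^ (0 + 1) = q from pow_one q]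
          module
        rw [hb1, one_mul, mul_one, e, mul_smul_comm, smul_mul_assoc]
        exact ⟨by rw [hsdef, h2, smul_zero], by rw [hsdef, h1, smul_zero]⟩
      · have hn : qInt q ((n + 2 : ℕ) : ℤ) ≠ 0 := hR.qInt_ne_zero (by omega)
        set a := extendOne (extendOne (skewSymmetrizer R q (n + 1)))
        have hb' : qInt q ((n + 2 : ℕ) : ℤ) • b = a * (q ^ (n + 1) • 1 -
            qInt q ((n + 1 : ℕ) : ℤ) • adjOp R (n + 3) n (by omega)) * a := by
          rw [hbdef, skewSymmetrizer_succ_succ, extendOne_smul, smul_inv_smul₀ hn,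
            QuantumDet.extendOne_mul, QuantumDet.extendOne_mul, extendOne_sub, extendOne_smul,
            extendOne_smul, extendOne_one, extendOne_adjOp]
        have hab : a * b = b := by rw [hbdef, ← QuantumDet.extendOne_mul, ih.extendOne_mul]
        have hba : b * a = b := by rw [hbdef, ← QuantumDet.extendOne_mul, ih.mul_extendOne]
        have hsa : Commute s a := commute_adjOp_extendOne_extendOne R _
        have hbr := braid_adjOp hR.braid (p := n + 3) (k := n) (by omega)
        have hl := congrArg extendOne (ih.left n (by omega))
        have hr := congrArg extendOne (ih.right n (by omega))
        rw [QuantumDet.extendOne_mul, extendOne_smul, extendOne_adjOp] at hl hr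
        rw [pow_succ q (n + 1)]
        exact ⟨hecke_step_left hb' hab hbb hsa hbr hl (hR.adjOp_mul' _),
          hecke_step_right hb' hba hbb hsa hbr hr (hR.adjOp_mul _)⟩
    refine ⟨fun j h => ?_, fun j h => ?_, ?_, hbA, hAb⟩
    · rcases Nat.lt_succ_iff_lt_or_eq.1 (Nat.succ_lt_succ_iff.1 h) with hj | rfl
      · have hl := congrArg extendOne (ih.left j (by omega))
        rw [QuantumDet.extendOne_mul, extendOne_smul, extendOne_adjOp] at hl
        rw [← hbA, ← mul_assoc, hl, smul_mul_assoc]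
      · exact key.1
    · rcases Nat.lt_succ_iff_lt_or_eq.1 (Nat.succ_lt_succ_iff.1 h) with hj | rfl
      · have hr := congrArg extendOne (ih.right j (by omega))
        rw [QuantumDet.extendOne_mul, extendOne_smul, extendOne_adjOp] at hr
        rw [← hAb, mul_assoc, hr, mul_smul_comm]
      · exact key.2
    · have hn : qInt q ((n + 2 : ℕ) : ℤ) ≠ 0 := hR.qInt_ne_zero (by omega)
      -- Acting on `A^{(n+2)}`, `b` becomes `1` and `s` becomes `-q⁻¹`; the bracket is then `q^{n+1}
      -- + q⁻¹ (n+1)_q = (n+2)_q`, which cancels the normalisation.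
      nth_rewrite 1 [hA]
      rw [smul_mul_assoc, mul_assoc, hbA, mul_assoc, sub_mul, smul_mul_assoc, smul_mul_assoc,
        key.1, one_mul, smul_smul, ← sub_smul, mul_smul_comm, hbA, smul_smul,
        show q ^ (n + 1) - qInt q ((n + 1 : ℕ) : ℤ) * -q⁻¹ = qInt q ((n + 2 : ℕ) : ℤ) by
          rw [qInt_succ hq0 hq (n + 1)]; ring, inv_mul_cancel₀ hn, one_smul]

theorem IsHeckeSymmetry.skewSymmetrizer_idem (hR : IsHeckeSymmetry R q) (k : ℕ) :
    skewSymmetrizer R q k * skewSymmetrizer R q k = skewSymmetrizer R q k := by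
  cases k with
  | zero => simp [skewSymmetrizer]
  | succ k => exact (hR.skewSymmetrizerProps k).idem

theorem IsHeckeSymmetry.adjOp_mul_skewSymmetrizer (hR : IsHeckeSymmetry R q) {p j : ℕ}
    (h : j + 1 < p) :
    adjOp R p j h * skewSymmetrizer R q p = -q⁻¹ • skewSymmetrizer R q p := by
  cases p with
  | zero => omega
  | succ k => exact (hR.skewSymmetrizerProps k).left j h

theorem IsHeckeSymmetry.skewSymmetrizer_mul_adjOp (hR : IsHeckeSymmetry R q) {p j : ℕ}
    (h : j + 1 < p) :
    skewSymmetrizer R q p * adjOp R p j h = -q⁻¹ • skewSymmetrizer R q p := by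
  cases p with
  | zero => omega
  | succ k => exact (hR.skewSymmetrizerProps k).right j h

end SkewSymmetrizer

/-! ### Splitting off the last index -/

section Snoc

variable {N k : ℕ}

/-- The multi-index `f` followed by `i`. -/
abbrev snocIdx (f : Fin k → Fin N) (i : Fin N) : Fin (k + 1) → Fin N := Fin.snoc f i

theorem sum_snocIdx {B : Type*} [AddCommMonoid B] (F : (Fin (k + 1) → Fin N) → B) :
    ∑ h, F h = ∑ f : Fin k → Fin N, ∑ i, F (snocIdx f i) := by
  rw [← Fintype.sum_prod_type' (f := fun f i => F (snocIdx f i))]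
  refine Finset.sum_bij' (fun h _ => (Fin.init h, h (Fin.last k))) (fun x _ => snocIdx x.1 x.2)
    ?_ ?_ ?_ ?_ ?_ <;> simp [snocIdx]

theorem extendOne_snocIdx (M : TMat N k ℂ) (f g : Fin k → Fin N) (i j : Fin N) :
    extendOne M (snocIdx f i) (snocIdx g j) = if i = j then M f g else 0 := by
  simp [extendOne, snocIdx]

theorem adjOp_snocIdx (M : Mat2 N) (f g : Fin k → Fin N) (i j a b : Fin N) :
    adjOp M (k + 2) k (Nat.lt_succ_self _) (snocIdx (snocIdx f i) j) (snocIdx (snocIdx g a) b) =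
      if f = g then M (i, j) (a, b) else 0 := by
  have h1 : (⟨k, Nat.lt_of_succ_lt (Nat.lt_succ_self _)⟩ : Fin (k + 2)) =
    (Fin.last k).castSucc := rfl
  have h2 : (⟨k + 1, Nat.lt_succ_self _⟩ : Fin (k + 2)) = Fin.last (k + 1) := rfl
  unfold adjOp pairOp
  rw [h1, h2]
  refine if_congr ⟨fun h => ?_, ?_⟩ (by simp [snocIdx]) rfl
  · funext c
    have := h c.castSucc.castSucc (by simp [Fin.ext_iff]; omega) (by simp [Fin.ext_iff]; omega)
    simpa [snocIdx] using this
  · rintro rfl c hc1 hc2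
    induction c using Fin.lastCases with
    | last => exact absurd rfl hc2
    | cast c =>
      induction c using Fin.lastCases with
      | last => exact absurd rfl hc1
      | cast c => simp [snocIdx]

theorem mulVec_snocIdx (M : TMat N k ℂ) (w : (Fin (k + 1) → Fin N) → ℂ) (f : Fin k → Fin N)
    (j : Fin N) :
    (extendOne M).mulVec w (snocIdx f j) = M.mulVec (fun g => w (snocIdx g j)) f := by
  simp only [Matrix.mulVec, dotProduct]
  rw [sum_snocIdx]
  simp [extendOne_snocIdx]

theorem adjOp_mulVec_snocIdx (M : Mat2 N) (w : (Fin (k + 2) → Fin N) → ℂ) (f : Fin k → Fin N)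
    (i j : Fin N) :
    (adjOp M (k + 2) k (Nat.lt_succ_self _)).mulVec w (snocIdx (snocIdx f i) j) =
      ∑ a, ∑ b, M (i, j) (a, b) * w (snocIdx (snocIdx f a) b) := by
  simp only [Matrix.mulVec, dotProduct]
  rw [sum_snocIdx, sum_snocIdx, Finset.sum_eq_single f]
  · simp [adjOp_snocIdx]
  · intro g _ hg
    refine Finset.sum_eq_zero fun a _ => Finset.sum_eq_zero fun b _ => ?_
    rw [adjOp_snocIdx, if_neg hg.symm, zero_mul]
  · simp

end Snoc

/-! ### A representation of the skew-symmetric algebra, and vanishing of skew-symmetrizers -/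

section SkewAlgebra

variable {N : ℕ} {R : Mat2 N} {q : ℂ}

/-- The operator of the generator `x_i` of `Λ_R(V)` on the space of functionals on the tensor
algebra. -/
def skewAct (R : Mat2 N) (q : ℂ) (i : Fin N) :
    Module.End ℂ ((k : ℕ) → (Fin k → Fin N) → ℂ) where
  toFun φ k f := (skewSymmetrizer R q (k + 1)).mulVec (φ (k + 1)) (snocIdx f i)
  map_add' φ ψ := by
    funext k f
    simp [Matrix.mulVec_add]
  map_smul' c φ := by
    funext k f
    simp [Matrix.mulVec_smul]

/-- Nesting `(A^{(k)} ⊗ I) A^{(k+1)} = A^{(k+1)}` makes the projectors of successive generators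
collapse to one. -/
theorem mulVec_skewAct (hR : IsHeckeSymmetry R q) (i : Fin N)
    (φ : (k : ℕ) → (Fin k → Fin N) → ℂ) (k : ℕ) (f : Fin k → Fin N) :
    (skewSymmetrizer R q k).mulVec (skewAct R q i φ k) f =
      (skewSymmetrizer R q (k + 1)).mulVec (φ (k + 1)) (snocIdx f i) := by
  have : skewAct R q i φ k =
    fun g => (skewSymmetrizer R q (k + 1)).mulVec (φ (k + 1)) (snocIdx g i) := rfl
  rw [this, ← mulVec_snocIdx, Matrix.mulVec_mulVec, (hR.skewSymmetrizerProps k).extendOne_mul]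

/-- Two generators produce `A^{(k+2)}` with its last two row indices exposed, so the defining
relation is `R A = -q⁻¹ A` in the last two positions. -/
theorem skewAct_rel (hR : IsHeckeSymmetry R q) (i j : Fin N) :
    q⁻¹ • (skewAct R q i * skewAct R q j) +
      ∑ a, ∑ b, R (i, j) (a, b) • (skewAct R q a * skewAct R q b) = 0 := by
  refine LinearMap.ext fun φ => ?_
  funext k f
  have h2 : ∀ i j, (skewAct R q i * skewAct R q j) φ k f =
      (skewSymmetrizer R q (k + 2)).mulVec (φ (k + 2)) (snocIdx (snocIdx f i) j) := fun i j =>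
    mulVec_skewAct hR j φ (k + 1) (snocIdx f i)
  have h3 := adjOp_mulVec_snocIdx R ((skewSymmetrizer R q (k + 2)).mulVec (φ (k + 2))) f i j
  rw [Matrix.mulVec_mulVec, hR.adjOp_mul_skewSymmetrizer, Matrix.smul_mulVec] at h3
  simp only [LinearMap.add_apply, LinearMap.smul_apply, LinearMap.sum_apply, Pi.add_apply,
    Pi.smul_apply, Finset.sum_apply, h2, smul_eq_mul, ← h3, LinearMap.zero_apply, Pi.zero_apply]
  ring

/-- The representation of `Λ_R(V)` by the operators `skewAct`. -/
def skewRep (hR : IsHeckeSymmetry R q) :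
    SkewAlg R q →ₐ[ℂ] Module.End ℂ ((k : ℕ) → (Fin k → Fin N) → ℂ) :=
  RingQuot.liftAlgHom ℂ ⟨FreeAlgebra.lift ℂ (skewAct R q), by
    rintro _ _ ⟨i, j⟩
    simpa using skewAct_rel hR i j⟩

theorem skewRep_mk (hR : IsHeckeSymmetry R q) (i : Fin N) :
    skewRep hR (RingQuot.mkAlgHom ℂ (SkewRel R q) (FreeAlgebra.ι ℂ i)) = skewAct R q i := by
  simp [skewRep]

theorem skewRep_word (hR : IsHeckeSymmetry R q) (k : ℕ) (f : Fin k → Fin N)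
    (φ : (k : ℕ) → (Fin k → Fin N) → ℂ) :
    skewRep hR (List.ofFn fun a =>
      RingQuot.mkAlgHom ℂ (SkewRel R q) (FreeAlgebra.ι ℂ (f a))).prod φ 0 default =
      (skewSymmetrizer R q k).mulVec (φ k) f := by
  induction k generalizing φ with
  | zero => simp [skewSymmetrizer, Subsingleton.elim f default]
  | succ k ih =>
    rw [List.ofFn_succ', List.concat_eq_append, List.prod_append, List.prod_singleton, map_mul,
      skewRep_mk, Module.End.mul_apply, ih (fun a => f a.castSucc), mulVec_skewAct hR]
    congr 1
    exact Fin.snoc_init_self f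

theorem skewSymmetrizer_eq_zero (hR : IsHeckeSymmetry R q) {k : ℕ}
    (h : skewComponent R q k = ⊥) : skewSymmetrizer R q k = 0 := by
  classical
  ext f g
  have hf : (List.ofFn fun a =>
      RingQuot.mkAlgHom ℂ (SkewRel R q) (FreeAlgebra.ι ℂ (f a))).prod = 0 := by
    have : (List.ofFn fun a => RingQuot.mkAlgHom ℂ (SkewRel R q) (FreeAlgebra.ι ℂ (f a))).prod ∈
        skewComponent R q k := Submodule.subset_span ⟨f, rfl⟩
    rw [h] at this
    simpa using this
  -- The functional supported in degree `k` at the multi-index `g` extracts the entry `(f, g)` of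
  -- `A^{(k)}`.
  have := skewRep_word hR k f (Function.update 0 k (Pi.single g 1))
  rw [hf, map_zero, Function.update_self, Matrix.mulVec_single_one] at this
  exact this.symm

end SkewAlgebra

/-! ### Skew-invertibility and the commutation of `C ⊗ C` with `R` -/

section SkewInverse

variable {N : ℕ} {R Ψ : Mat2 N} {q : ℂ}

theorem sum_rotate {α β γ B : Type*} [Fintype α] [Fintype β] [Fintype γ] [AddCommMonoid B]
    (F : α → β → γ → B) : ∑ a, ∑ b, ∑ c, F a b c = ∑ c, ∑ a, ∑ b, F a b c :=
  (Finset.sum_congr rfl fun _ _ => Finset.sum_comm).trans Finset.sum_comm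

theorem sum_three {B : Type*} [AddCommMonoid B] (F : (Fin 3 → Fin N) → B) :
    ∑ h, F h = ∑ a, ∑ b, ∑ c, F ![a, b, c] := by
  rw [← Fintype.sum_prod_type' (f := fun a b => ∑ c, F ![a, b, c]),
    ← Fintype.sum_prod_type' (f := fun (x : Fin N × Fin N) c => F ![x.1, x.2, c])]
  refine Finset.sum_bij' (fun h _ => ((h 0, h 1), h 2)) (fun x _ => ![x.1.1, x.1.2, x.2])
    ?_ ?_ ?_ ?_ ?_
  · simp
  · simp
  · intro h _
    funext i
    fin_cases i <;> rfl
  · simp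
  · intro h _
    congr 1
    funext i
    fin_cases i <;> rfl

theorem pairOp_zero_one_apply (X : Mat2 N) (i j k l m n : Fin N) :
    (pairOp X 0 1 : TMat N 3 ℂ) ![i, j, k] ![l, m, n] = if k = n then X (i, j) (l, m) else 0 := by
  simp [pairOp, Fin.forall_fin_succ]

theorem pairOp_one_two_apply (X : Mat2 N) (i j k l m n : Fin N) :
    (pairOp X 1 2 : TMat N 3 ℂ) ![i, j, k] ![l, m, n] = if i = l then X (j, k) (m, n) else 0 := by
  simp [pairOp, Fin.forall_fin_succ]

theorem pairOp_three_apply (X Y Z : Mat2 N) (i j k l m n : Fin N) :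
    (pairOp X 0 1 * pairOp Y 1 2 * pairOp Z 0 1 : TMat N 3 ℂ) ![i, j, k] ![l, m, n] =
      ∑ a, ∑ b, ∑ c, X (i, j) (a, b) * Y (b, k) (c, n) * Z (a, c) (l, m) := by
  simp only [Matrix.mul_apply, sum_three, pairOp_zero_one_apply, pairOp_one_two_apply]
  simp only [mul_ite, ite_mul, mul_zero, zero_mul, Finset.sum_ite_irrel, Finset.sum_const_zero,
    Finset.sum_ite_eq, Finset.sum_ite_eq', Finset.mem_univ, if_true, Finset.sum_mul]
  refine Finset.sum_congr rfl fun a _ => ?_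
  exact Finset.sum_comm

theorem pairOp_three_apply' (X Y Z : Mat2 N) (i j k l m n : Fin N) :
    (pairOp X 1 2 * pairOp Y 0 1 * pairOp Z 1 2 : TMat N 3 ℂ) ![i, j, k] ![l, m, n] =
      ∑ a, ∑ b, ∑ c, X (j, k) (b, c) * Y (i, b) (l, a) * Z (a, c) (m, n) := by
  simp only [Matrix.mul_apply, sum_three, pairOp_zero_one_apply, pairOp_one_two_apply]
  simp only [mul_ite, ite_mul, mul_zero, zero_mul, Finset.sum_ite_irrel, Finset.sum_const_zero,
    Finset.sum_ite_eq, Finset.sum_ite_eq', Finset.mem_univ, if_true, Finset.sum_mul]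
  refine Finset.sum_congr rfl fun a _ => ?_
  exact Finset.sum_comm

/-- The Hecke relation rearranged; it makes `R` invertible. -/
theorem IsHeckeSymmetry.mul_sub_smul (hR : IsHeckeSymmetry R q) :
    R * (R - (q - q⁻¹) • 1) = 1 := by
  have h := hR.hecke
  rw [sub_mul, mul_add, mul_smul_comm, smul_mul_assoc, one_mul, smul_add,
    mul_one, smul_smul, mul_inv_cancel₀ hR.q_ne_zero] at h
  rw [mul_sub, mul_smul_comm, mul_one, ← sub_eq_zero, ← h]
  module

theorem IsHeckeSymmetry.isUnit_det (hR : IsHeckeSymmetry R q) : IsUnit R.det :=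
  (Matrix.isUnit_iff_isUnit_det R).1 (IsUnit.of_mul_eq_one _ hR.mul_sub_smul)

theorem IsHeckeSymmetry.mul_inv (hR : IsHeckeSymmetry R q) : R * R⁻¹ = 1 :=
  Matrix.mul_nonsing_inv _ hR.isUnit_det

theorem IsHeckeSymmetry.inv_mul (hR : IsHeckeSymmetry R q) : R⁻¹ * R = 1 :=
  Matrix.nonsing_inv_mul _ hR.isUnit_det

/-- `R` as a matrix from the indices of the first factor to those of the second one. -/
def reshape (R : Mat2 N) : Mat2 N := fun x y => R (x.1, y.1) (x.2, y.2)

/-- The reshaped skew inverse. -/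
def reshapeInv (Ψ : Mat2 N) : Mat2 N := fun x y => Ψ (x.2, y.2) (x.1, y.1)

/-- After regrouping indices by tensor factor, the second skew-inverse identity is an ordinary
matrix inverse, so `R` can be cancelled from contracted equations. -/
theorem IsSkewInverse.reshapeInv_mul (hΨ : IsSkewInverse R Ψ) :
    reshapeInv Ψ * reshape R = 1 := by
  ext ⟨k, i⟩ ⟨m, n⟩
  rw [Matrix.mul_apply, Fintype.sum_prod_type, Finset.sum_comm]
  refine (hΨ i k m n).2.trans ?_
  rw [Matrix.one_apply]
  refine if_congr ?_ rfl rfl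
  rw [Prod.mk.injEq, eq_comm (a := m)]

theorem IsSkewInverse.eq_of_reshape_mul (hΨ : IsSkewInverse R Ψ) {X Y : Mat2 N}
    (h : reshape R * X = Y) : X = reshapeInv Ψ * Y := by
  rw [← h, ← mul_assoc, hΨ.reshapeInv_mul, one_mul]

theorem IsSkewInverse.trace_mul (hΨ : IsSkewInverse R Ψ) (b c : Fin N) :
    ∑ k, ∑ n, R (b, k) (c, n) * traceMatrix Ψ n k = if b = c then 1 else 0 := by
  simp only [traceMatrix, Finset.mul_sum]
  calc _ = ∑ m, ∑ k, ∑ n, R (b, k) (c, n) * Ψ (n, m) (k, m) := by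
        exact sum_rotate _
    _ = ∑ m, if m = c ∧ b = m then (1 : ℂ) else 0 := 
        Finset.sum_congr rfl fun m _ => (hΨ b c m m).1
    _ = _ := by
      simp only [ite_and, Finset.sum_ite_eq', Finset.mem_univ, if_true]

/-- Only `R₂₃` touches the third position, and its `C`-trace there is the identity; what is left is
`X Z = 1`. -/
theorem IsSkewInverse.trace_three (hΨ : IsSkewInverse R Ψ) {X Z : Mat2 N} (hXZ : X * Z = 1)
    (i j l m : Fin N) :
    ∑ k, ∑ n, traceMatrix Ψ n k *
      (pairOp X 0 1 * pairOp R 1 2 * pairOp Z 0 1 : TMat N 3 ℂ) ![i, j, k] ![l, m, n] =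
    if i = l ∧ j = m then 1 else 0 := by
  have h : ∀ a b c, (∑ k, ∑ n, traceMatrix Ψ n k * (X (i, j) (a, b) * R (b, k) (c, n) *
      Z (a, c) (l, m))) = X (i, j) (a, b) * (if b = c then 1 else 0) * Z (a, c) (l, m) := by
    intro a b c
    rw [← hΨ.trace_mul b c, Finset.mul_sum, Finset.sum_mul]
    refine Finset.sum_congr rfl fun k _ => ?_
    rw [Finset.mul_sum, Finset.sum_mul]
    exact Finset.sum_congr rfl fun n _ => by ring
  calc _ = ∑ a, ∑ b, ∑ c, ∑ k, ∑ n, traceMatrix Ψ n k * (X (i, j) (a, b) * R (b, k) (c, n) *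
      Z (a, c) (l, m)) := by
        simp only [pairOp_three_apply, Finset.mul_sum]
        rw [sum_rotate]
        refine Finset.sum_congr rfl fun a _ => ?_
        rw [sum_rotate]
        exact Finset.sum_congr rfl fun b _ => sum_rotate _
    _ = ∑ a, ∑ b, X (i, j) (a, b) * Z (a, b) (l, m) := by
        simp [h]
    _ = (X * Z) (i, j) (l, m) := by
        rw [Matrix.mul_apply, Fintype.sum_prod_type]
    _ = _ := by
        rw [hXZ, Matrix.one_apply]
        simp only [Prod.mk.injEq]

/-- The `C`-trace over the third position of the hypothesis `h` is the identity by `trace_three`. On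
the other side `R₁₂` is the only factor meeting the first position, so it is cancelled by `Ψ`;
contracting `Ψ` with the identity produces `C`. -/
theorem IsSkewInverse.reshape_mul_eq (hΨ : IsSkewInverse R Ψ) {X Z X' Z' : Mat2 N}
    (hXZ : X * Z = 1) (h : (pairOp X' 1 2 * pairOp R 0 1 * pairOp Z' 1 2 : TMat N 3 ℂ) =
      pairOp X 0 1 * pairOp R 1 2 * pairOp Z 0 1) (a b j m : Fin N) :
    ∑ k, ∑ n, ∑ c, traceMatrix Ψ n k * (X' (j, k) (b, c) * Z' (a, c) (m, n)) =
      if j = m then traceMatrix Ψ a b else 0 := by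
  have key : reshape R * (Matrix.of fun x y => ∑ k, ∑ n, ∑ c, traceMatrix Ψ n k *
      (X' (y.1, k) (x.1, c) * Z' (x.2, c) (y.2, n))) =
      Matrix.of fun x y => if x.1 = x.2 ∧ y.1 = y.2 then 1 else 0 := by
    ext ⟨i, l⟩ ⟨j, m⟩
    have h1 := hΨ.trace_three hXZ i j l m
    rw [← h] at h1
    refine Eq.trans ?_ h1
    rw [Matrix.mul_apply, Fintype.sum_prod_type]
    simp only [pairOp_three_apply', reshape, Matrix.of_apply, Finset.mul_sum]
    rw [Finset.sum_comm]
    refine Eq.trans (Finset.sum_congr rfl fun a _ => ?_) (sum_rotate _).symm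
    refine Eq.trans ?_ (sum_rotate _).symm
    exact Finset.sum_congr rfl fun b _ => Finset.sum_congr rfl fun k _ =>
      Finset.sum_congr rfl fun n _ => Finset.sum_congr rfl fun c _ => by ring
  have h2 := congrFun (congrFun (hΨ.eq_of_reshape_mul key) (b, a)) (j, m)
  refine h2.trans ?_
  rw [Matrix.mul_apply, Fintype.sum_prod_type]
  by_cases hjm : j = m
  · simp [reshapeInv, hjm, traceMatrix]
  · simp [hjm]

theorem IsHeckeSymmetry.braid_inv_left (hR : IsHeckeSymmetry R q) :
    (pairOp R⁻¹ 1 2 * pairOp R 0 1 * pairOp R 1 2 : TMat N 3 ℂ) =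
      pairOp R 0 1 * pairOp R 1 2 * pairOp R⁻¹ 0 1 := by
  have h01 : (pairOp R 0 1 * pairOp R⁻¹ 0 1 : TMat N 3 ℂ) = 1 := by
    rw [← pairOp_mul _ _ (by decide), hR.mul_inv, pairOp_one (by decide)]
  have h12 : (pairOp R⁻¹ 1 2 * pairOp R 1 2 : TMat N 3 ℂ) = 1 := by
    rw [← pairOp_mul _ _ (by decide), hR.inv_mul, pairOp_one (by decide)]
  have h := hR.braid
  unfold IsBraiding at h
  calc _ = pairOp R⁻¹ 1 2 * (pairOp R 0 1 * pairOp R 1 2 * pairOp R 0 1) * pairOp R⁻¹ 0 1 := by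
        simp only [mul_assoc, h01, mul_one]
    _ = (pairOp R⁻¹ 1 2 * pairOp R 1 2) * (pairOp R 0 1 * pairOp R 1 2 * pairOp R⁻¹ 0 1) := by
        rw [h]; simp only [mul_assoc]
    _ = _ := by rw [h12, one_mul]

theorem IsHeckeSymmetry.braid_inv_right (hR : IsHeckeSymmetry R q) :
    (pairOp R 1 2 * pairOp R 0 1 * pairOp R⁻¹ 1 2 : TMat N 3 ℂ) =
      pairOp R⁻¹ 0 1 * pairOp R 1 2 * pairOp R 0 1 := by
  have h01 : (pairOp R⁻¹ 0 1 * pairOp R 0 1 : TMat N 3 ℂ) = 1 := by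
    rw [← pairOp_mul _ _ (by decide), hR.inv_mul, pairOp_one (by decide)]
  have h12 : (pairOp R 1 2 * pairOp R⁻¹ 1 2 : TMat N 3 ℂ) = 1 := by
    rw [← pairOp_mul _ _ (by decide), hR.mul_inv, pairOp_one (by decide)]
  have h := hR.braid
  unfold IsBraiding at h
  calc _ = (pairOp R⁻¹ 0 1 * pairOp R 0 1) * (pairOp R 1 2 * pairOp R 0 1 * pairOp R⁻¹ 1 2) := by
        rw [h01, one_mul]
    _ = pairOp R⁻¹ 0 1 * (pairOp R 0 1 * pairOp R 1 2 * pairOp R 0 1) * pairOp R⁻¹ 1 2 := by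
        simp only [mul_assoc]
    _ = _ := by rw [h]; simp only [mul_assoc, h12, mul_one]

/-- In operator form this is `C₂ R⁻¹ = Ψ₂₁ C₁`. The contracted identity `reshape_mul_eq` still
contains a factor `R`, which is cancelled by `Ψ` a second time. The companion `inv_mul_trace` is
`R⁻¹ C₂ = C₁ Ψ₂₁`, from the mirrored form of the braid relation. -/
theorem IsSkewInverse.trace_mul_inv (hΨ : IsSkewInverse R Ψ) (hR : IsHeckeSymmetry R q)
    (i j k b : Fin N) :
    ∑ c, traceMatrix Ψ i c * R⁻¹ (j, c) (b, k) = ∑ l, Ψ (i, j) (k, l) * traceMatrix Ψ l b := by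
  have key : reshape R * (Matrix.of fun x y =>
      ∑ k, traceMatrix Ψ x.2 k * R⁻¹ (y.1, k) (y.2, x.1)) =
      Matrix.of fun x y => if y.1 = x.2 then traceMatrix Ψ x.1 y.2 else 0 := by
    ext ⟨a, m⟩ ⟨j, b⟩
    refine Eq.trans ?_ (hΨ.reshape_mul_eq hR.mul_inv hR.braid_inv_left a b j m)
    rw [Matrix.mul_apply, Fintype.sum_prod_type]
    simp only [reshape, Matrix.of_apply, Finset.mul_sum]
    rw [sum_rotate]
    refine Finset.sum_congr rfl fun k _ => ?_
    rw [Finset.sum_comm]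
    exact Finset.sum_congr rfl fun n _ => Finset.sum_congr rfl fun c _ => by ring
  have h2 := congrFun (congrFun (hΨ.eq_of_reshape_mul key) (k, i)) (j, b)
  refine h2.trans ?_
  rw [Matrix.mul_apply, Fintype.sum_prod_type]
  simp [reshapeInv]

theorem IsSkewInverse.inv_mul_trace (hΨ : IsSkewInverse R Ψ) (hR : IsHeckeSymmetry R q)
    (a i m k : Fin N) :
    ∑ n, R⁻¹ (a, i) (m, n) * traceMatrix Ψ n k = ∑ j, traceMatrix Ψ a j * Ψ (i, j) (k, m) := by
  have key : reshape R * (Matrix.of fun x y =>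
      ∑ n, R⁻¹ (y.1, x.2) (y.2, n) * traceMatrix Ψ n x.1) =
      Matrix.of fun x y => if x.1 = y.2 then traceMatrix Ψ y.1 x.2 else 0 := by
    ext ⟨j, b⟩ ⟨a, m⟩
    refine Eq.trans ?_ (hΨ.reshape_mul_eq hR.inv_mul hR.braid_inv_right a b j m)
    rw [Matrix.mul_apply, Fintype.sum_prod_type]
    simp only [reshape, Matrix.of_apply, Finset.mul_sum]
    refine Finset.sum_congr rfl fun k _ => ?_
    rw [Finset.sum_comm]
    exact Finset.sum_congr rfl fun n _ => Finset.sum_congr rfl fun c _ => by ring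
  have h2 := congrFun (congrFun (hΨ.eq_of_reshape_mul key) (k, i)) (a, m)
  refine h2.trans ?_
  rw [Matrix.mul_apply, Fintype.sum_prod_type]
  simp [reshapeInv, mul_comm]

-- Both sides equal `C₁ Ψ₂₁ C₁`.
open scoped Kronecker in
theorem IsSkewInverse.commute_inv (hΨ : IsSkewInverse R Ψ) (hR : IsHeckeSymmetry R q) :
    Commute (traceMatrix Ψ ⊗ₖ traceMatrix Ψ) R⁻¹ := by
  ext ⟨w, x⟩ ⟨m, y⟩
  rw [Matrix.mul_apply, Matrix.mul_apply, Fintype.sum_prod_type, Fintype.sum_prod_type]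
  simp only [Matrix.kroneckerMap_apply]
  calc _ = ∑ j, traceMatrix Ψ w j * ∑ c, traceMatrix Ψ x c * R⁻¹ (j, c) (m, y) := by
        simp only [Finset.mul_sum, mul_assoc]
    _ = ∑ l, (∑ j, traceMatrix Ψ w j * Ψ (x, j) (y, l)) * traceMatrix Ψ l m := by
        simp only [hΨ.trace_mul_inv hR, Finset.mul_sum, Finset.sum_mul, mul_assoc]
        exact Finset.sum_comm
    _ = _ := by
        simp only [← hΨ.inv_mul_trace hR, Finset.sum_mul]
        exact Finset.sum_congr rfl fun l _ => Finset.sum_congr rfl fun n _ => by ring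

open scoped Kronecker in
theorem IsSkewInverse.commute (hΨ : IsSkewInverse R Ψ) (hR : IsHeckeSymmetry R q) :
    Commute (traceMatrix Ψ ⊗ₖ traceMatrix Ψ) R := by
  have h := hΨ.commute_inv hR
  calc _ = (R * R⁻¹) * ((traceMatrix Ψ ⊗ₖ traceMatrix Ψ) * R) := by rw [hR.mul_inv, one_mul]
    _ = R * ((traceMatrix Ψ ⊗ₖ traceMatrix Ψ) * R⁻¹) * R := by rw [h.eq]; simp only [mul_assoc]
    _ = _ := by simp only [mul_assoc, hR.inv_mul, mul_one]

end SkewInverse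

/-! ### Partial `R`-traces -/

section PartialTrace

theorem place_castSuccEmb_snocIdx {N k : ℕ} {B : Type*} [Zero B] (M : TMat N k B) (f g : Fin k → Fin N) (i j : Fin N) :
    place Fin.castSuccEmb M (snocIdx f i) (snocIdx g j) = if i = j then M f g else 0 := by
  by_cases h : i = j
  · rw [place_apply_of, if_pos h]
    · congr 1 <;> funext a <;> simp [snocIdx]
    · intro c hc
      induction c using Fin.lastCases with
      | last => simpa [snocIdx] using h
      | cast c => exact absurd ⟨c, rfl⟩ hc
  · rw [place_apply_of_not, if_neg h]
    intro H
    refine h ?_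
    have := H (Fin.last k) (by simp)
    simpa [snocIdx] using this

variable {N k p : ℕ} {B : Type*} [Ring B] [Algebra ℂ B] (C : Matrix (Fin N) (Fin N) ℂ)

/-- The partial trace over the last position, weighted by `C`. -/
def ptrace (X : TMat N (k + 1) B) : TMat N k B :=
  fun f g => ∑ x, ∑ y, C x y • X (snocIdx f y) (snocIdx g x)

theorem multiTrace_ptrace (X : TMat N (k + 1) B) :
    multiTrace C (ptrace C X) = multiTrace C X := by
  unfold multiTrace ptrace
  rw [sum_snocIdx]
  refine Finset.sum_congr rfl fun f _ => ?_
  simp only [sum_snocIdx (k := k) (B := B), Finset.smul_sum]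
  rw [Finset.sum_comm]
  refine Finset.sum_congr rfl fun x _ => Finset.sum_congr rfl fun g _ =>
    Finset.sum_congr rfl fun y _ => ?_
  rw [Fin.prod_univ_castSucc, smul_smul]
  simp [snocIdx]

theorem ptrace_mul_place (X : TMat N (k + 1) B) (Y : TMat N k B) :
    ptrace C (X * place Fin.castSuccEmb Y) = ptrace C X * Y := by
  ext f g
  simp only [ptrace, Matrix.mul_apply, sum_snocIdx (k := k) (B := B), place_castSuccEmb_snocIdx,
    mul_ite, mul_zero, Finset.sum_ite_eq', Finset.mem_univ, if_true, Finset.sum_mul,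
    Finset.smul_sum, smul_mul_assoc]
  exact sum_rotate _

theorem ptrace_place_mul (X : TMat N (k + 1) B) (Y : TMat N k B) :
    ptrace C (place Fin.castSuccEmb Y * X) = Y * ptrace C X := by
  ext f g
  simp only [ptrace, Matrix.mul_apply, sum_snocIdx (k := k) (B := B), place_castSuccEmb_snocIdx,
    ite_mul, zero_mul, Finset.sum_ite_eq, Finset.mem_univ, if_true, Finset.mul_sum,
    Finset.smul_sum, mul_smul_comm]
  exact sum_rotate _

theorem ptrace_map (X : TMat N (k + 1) ℂ) :
    ptrace C (X.map (algebraMap ℂ B)) = (ptrace C X).map (algebraMap ℂ B) := by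
  ext f g
  simp [ptrace, Algebra.smul_def]

theorem ptrace_smul (s : ℂ) (X : TMat N (k + 1) ℂ) : ptrace C (s • X) = s • ptrace C X := by
  ext f g
  simp only [ptrace, Matrix.smul_apply, smul_eq_mul, Finset.mul_sum]
  exact Finset.sum_congr rfl fun x _ => Finset.sum_congr rfl fun y _ => by ring

theorem ptrace_sub (X Y : TMat N (k + 1) ℂ) : ptrace C (X - Y) = ptrace C X - ptrace C Y := by
  ext f g
  simp [ptrace, mul_sub]

theorem ptrace_one : ptrace C (1 : TMat N (k + 1) ℂ) = C.trace • 1 := by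
  rw [← extendOne_one]
  ext f g
  simp only [ptrace, extendOne_snocIdx, smul_ite, smul_zero, Finset.sum_ite_eq', Finset.mem_univ,
    if_true, Matrix.smul_apply, Matrix.trace, Matrix.diag_apply, Finset.sum_smul]

theorem IsSkewInverse.ptrace_adjOp {R Ψ : Mat2 N} (hΨ : IsSkewInverse R Ψ) :
    ptrace (traceMatrix Ψ) (adjOp R (k + 2) k (Nat.lt_succ_self _)) = 1 := by
  ext f' g'
  obtain ⟨f, i, rfl⟩ : ∃ f i, f' = snocIdx f i := ⟨_, _, (Fin.snoc_init_self f').symm⟩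
  obtain ⟨g, j, rfl⟩ : ∃ f i, g' = snocIdx f i := ⟨_, _, (Fin.snoc_init_self g').symm⟩
  have h := hΨ.trace_mul i j
  rw [Finset.sum_comm] at h
  rw [← extendOne_one, extendOne_snocIdx, Matrix.one_apply]
  simp only [ptrace, adjOp_snocIdx]
  by_cases hfg : f = g
  · simp only [hfg, if_true, smul_eq_mul]
    rw [← h]
    exact Finset.sum_congr rfl fun x _ => Finset.sum_congr rfl fun y _ => mul_comm _ _
  · simp [hfg]

/-- The outer projectors in the recursion do not touch the last position and leave the trace.
Inside, the identity contributes `Tr C` and `R` contributes `1`; idempotency merges the two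
projectors. -/
theorem ptrace_skewSymmetrizer {R Ψ : Mat2 N} {q : ℂ} (hR : IsHeckeSymmetry R q)
    (hΨ : IsSkewInverse R Ψ) (k : ℕ) :
    ptrace (traceMatrix Ψ) (skewSymmetrizer R q (k + 1)) =
      ((q ^ k * (traceMatrix Ψ).trace - qInt q (k : ℤ)) / qInt q ((k + 1 : ℕ) : ℤ)) •
        skewSymmetrizer R q k := by
  cases k with
  | zero =>
    have h1 : qInt q ((0 + 1 : ℕ) : ℤ) = 1 := by simpa using qInt_one hR.sub_inv_ne_zero
    have h0 : qInt q ((0 : ℕ) : ℤ) = 0 := qInt_zero q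
    rw [h1, h0]
    simp [skewSymmetrizer, ptrace_one]
  | succ k =>
    rw [skewSymmetrizer_succ_succ, ptrace_smul, extendOne_eq_place, ptrace_mul_place,
      ptrace_place_mul, ptrace_sub, ptrace_smul, ptrace_smul, ptrace_one, hΨ.ptrace_adjOp,
      smul_smul, ← sub_smul, mul_smul_comm, mul_one, smul_mul_assoc, hR.skewSymmetrizer_idem,
      smul_smul]
    congr 1
    rw [div_eq_inv_mul]

end PartialTrace

/-! ### The matrix `C₁ ⋯ C_p` commutes with skew-symmetrizers -/

section TensorPower

variable {N : ℕ} {R Ψ : Mat2 N} {q : ℂ}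

/-- The matrix `C_1 ⋯ C_p`. -/
def tensorPow (C : Matrix (Fin N) (Fin N) ℂ) (p : ℕ) : TMat N p ℂ := fun f g => ∏ a, C (f a) (g a)

theorem tensorPow_succ (C : Matrix (Fin N) (Fin N) ℂ) (p : ℕ) :
    tensorPow C (p + 1) = extendOne (tensorPow C p) * siteOp C (Fin.last p) := by
  rw [extendOne_eq_place, siteOp_eq_place]
  have hd : Disjoint (Set.range (Fin.castSuccEmb : Fin p ↪ Fin (p + 1)))
      (Set.range (siteEmb (Fin.last p))) := by
    rw [range_castSuccEmb, range_siteEmb]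
    exact disjoint_compl_left
  ext f g
  rw [place_mul_place_apply _ _ hd]
  · simp [tensorPow, Fin.prod_univ_castSucc, siteOp, siteEmb]
    exact Or.inl rfl
  · intro c h1 h2
    rw [range_castSuccEmb] at h1
    rw [range_siteEmb] at h2
    exact absurd h2 h1

open scoped Kronecker in
theorem tensorPow_succ_succ (C : Matrix (Fin N) (Fin N) ℂ) (p : ℕ) :
    tensorPow C (p + 2) = extendOne (extendOne (tensorPow C p)) *
      adjOp (C ⊗ₖ C) (p + 2) p (Nat.lt_succ_self _) := by
  have h : adjOp (C ⊗ₖ C) (p + 2) p (Nat.lt_succ_self _) =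
      siteOp C (Fin.last p).castSucc * siteOp C (Fin.last (p + 1)) := by
    have hne : (Fin.last p).castSucc ≠ Fin.last (p + 1) := (Fin.castSucc_lt_last _).ne
    rw [siteOp_eq_place, siteOp_eq_place C (Fin.last (p + 1))]
    have hd : Disjoint (Set.range (siteEmb (Fin.last p).castSucc))
        (Set.range (siteEmb (Fin.last (p + 1)))) := by
      simp [range_siteEmb]
    ext f g
    have hoff : ∀ c, (c ∉ Set.range (siteEmb (Fin.last p).castSucc) →
        c ∉ Set.range (siteEmb (Fin.last (p + 1))) → f c = g c) ↔
        (c ≠ (Fin.last p).castSucc → c ≠ Fin.last (p + 1) → f c = g c) := by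
      intro c
      rw [range_siteEmb, range_siteEmb]
      rfl
    by_cases H : ∀ c, c ≠ (Fin.last p).castSucc → c ≠ Fin.last (p + 1) → f c = g c
    · rw [place_mul_place_apply _ _ hd _ _ fun c => (hoff c).2 (H c)]
      refine (if_pos H).trans ?_
      simp [siteOp, siteEmb]
      rfl
    · rw [place_mul_place_apply_of_not _ _ _ _ fun H' => H fun c => (hoff c).1 (H' c)]
      exact if_neg H
  rw [tensorPow_succ, tensorPow_succ, h, extendOne_mul, mul_assoc]
  congr 2
  rw [extendOne_eq_place]
  exact place_siteOp _ _ _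

theorem commute_extendOne {p : ℕ} {X Y : TMat N p ℂ} (h : Commute X Y) :
    Commute (extendOne X) (extendOne Y) := by
  unfold Commute SemiconjBy
  rw [← extendOne_mul, ← extendOne_mul, h.eq]

theorem IsSkewInverse.commute_tensorPow (hΨ : IsSkewInverse R Ψ) (hR : IsHeckeSymmetry R q)
    (p : ℕ) : Commute (tensorPow (traceMatrix Ψ) p) (skewSymmetrizer R q p) := by
  induction p with
  | zero => exact Commute.one_right _
  | succ p ih =>
    cases p with
    | zero => exact Commute.one_right _
    | succ p =>
      have h1 : Commute (tensorPow (traceMatrix Ψ) (p + 2))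
          (extendOne (skewSymmetrizer R q (p + 1))) := by
        rw [tensorPow_succ]
        refine (commute_extendOne ih).mul_left ?_
        rw [extendOne_eq_place, siteOp_eq_place]
        refine commute_place _ _ ?_ _ _ fun _ _ _ _ => Commute.all _ _
        rw [range_castSuccEmb, range_siteEmb]
        exact disjoint_compl_right
      have h2 : Commute (tensorPow (traceMatrix Ψ) (p + 2))
          (adjOp R (p + 2) p (Nat.lt_succ_self _)) := by
        rw [tensorPow_succ_succ]
        refine (commute_adjOp_extendOne_extendOne R _).symm.mul_left ?_
        unfold Commute SemiconjBy adjOp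
        rw [← pairOp_mul _ _ (adj_ne _), ← pairOp_mul _ _ (adj_ne _), (hΨ.commute hR).eq]
      rw [skewSymmetrizer_succ_succ]
      exact ((h1.mul_right (((Commute.one_right _).smul_right _).sub_right
        (h2.smul_right _))).mul_right h1).smul_right _

end TensorPower

/-! ### Commutation of neighbouring `R` with the copies of `L` -/

section Copies

theorem siteOp_sub_scalar {N p : ℕ} {B : Type*} [Ring B] (M : Matrix (Fin N) (Fin N) B) (c : B) (a : Fin p) :
    siteOp (M - Matrix.scalar (Fin N) c) a = siteOp M a - Matrix.scalar (Fin p → Fin N) c := by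
  ext f g
  simp only [siteOp, Matrix.sub_apply, Matrix.scalar_apply, Matrix.diagonal_apply]
  by_cases h : ∀ b, b ≠ a → f b = g b
  · rw [if_pos h, if_pos h]
    congr 1
    refine if_congr ⟨fun h' => ?_, fun h' => by rw [h']⟩ rfl rfl
    funext b
    by_cases hb : b = a
    · rw [hb, h']
    · exact h b hb
  · rw [if_neg h, if_neg h, if_neg fun h' => h fun b _ => by rw [h'], sub_zero]

variable {N p : ℕ} {B : Type*} [Ring B] [Algebra ℂ B] {R : Mat2 N} {q : ℂ}
  (L : Matrix (Fin N) (Fin N) B)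

theorem barCopy_succ (F : Mat2 N) {k : ℕ} (h : k + 1 < p) :
    barCopy F L p (k + 1) h = (adjOp F p k h).map (algebraMap ℂ B) *
      barCopy F L p k (Nat.lt_of_succ_lt h) * (adjOp F⁻¹ p k h).map (algebraMap ℂ B) := rfl

theorem adjOp_mul_eq_one {M M' : Mat2 N} (hM : M * M' = 1) {k : ℕ} (h : k + 1 < p) :
    adjOp M p k h * adjOp M' p k h = 1 := by
  unfold adjOp
  rw [← pairOp_mul _ _ (adj_ne h), hM, pairOp_one (adj_ne h)]

theorem map_adjOp_mul_eq_one {M M' : Mat2 N} (hM : M * M' = 1) {k : ℕ} (h : k + 1 < p) :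
    (adjOp M p k h).map (algebraMap ℂ B) * (adjOp M' p k h).map (algebraMap ℂ B) = 1 := by
  rw [← map_algebraMap_mul, adjOp_mul_eq_one hM, Matrix.map_one _ (map_zero _) (map_one _)]

/-- A central scalar matrix is fixed by conjugation. -/
theorem barCopy_sub_scalar {F : Mat2 N} (hF : F * F⁻¹ = 1) (c : B) (hc : ∀ b, Commute c b) (k : ℕ)
    (h : k < p) : barCopy F (L - Matrix.scalar (Fin N) c) p k h =
      barCopy F L p k h - Matrix.scalar (Fin p → Fin N) c := by
  induction k with
  | zero => exact siteOp_sub_scalar L c _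
  | succ k ih =>
    rw [barCopy_succ, ih, barCopy_succ, mul_sub, sub_mul]
    congr 1
    rw [← (Matrix.scalar_commute c hc _).eq, mul_assoc, map_adjOp_mul_eq_one hF, mul_one]

theorem place_barCopy (F : Mat2 N) (k : ℕ) (h : k < p) :
    place Fin.castSuccEmb (barCopy F L p k h) = barCopy F L (p + 1) k (Nat.lt_succ_of_lt h) := by
  induction k with
  | zero => exact place_siteOp _ _ _
  | succ k ih =>
    rw [barCopy_succ, barCopy_succ, place_mul, place_mul, ih, place_map _ (map_zero _),
      place_map _ (map_zero _), ← extendOne_eq_place, ← extendOne_eq_place, extendOne_adjOp,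
      extendOne_adjOp]

theorem barCopy_map {B' : Type*} [Ring B'] [Algebra ℂ B'] (φ : B →ₐ[ℂ] B') (F : Mat2 N) (k : ℕ)
    (h : k < p) : barCopy F (L.map φ) p k h = (barCopy F L p k h).map φ := by
  have hφ : ∀ X : TMat N p ℂ, X.map (algebraMap ℂ B') = (X.map (algebraMap ℂ B)).map φ := by
    intro X
    ext f g
    simp
  induction k with
  | zero =>
    ext f g
    simp only [barCopy, siteOp, Matrix.map_apply]
    split_ifs <;> simp
  | succ k ih =>
    rw [barCopy_succ, barCopy_succ, ih, hφ, hφ, ← Matrix.map_mul, ← Matrix.map_mul]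

theorem commute_adjOp_adjOp (M M' : Mat2 N) {j k : ℕ} (hj : j + 1 < p) (hk : k + 1 < p)
    (hjk : k + 1 < j) :
    Commute ((adjOp M p j hj).map (algebraMap ℂ B)) ((adjOp M' p k hk).map (algebraMap ℂ B)) := by
  unfold adjOp
  rw [pairOp_eq_place M' (adj_ne hk), ← place_map _ (map_zero _)]
  refine commute_pairOp_place M (adj_ne hj) _ ?_ ?_ _ <;>
  · rw [range_pairEmb]
    simp [Fin.ext_iff]
    omega

theorem commute_adjOp_barCopy_of_lt (M F : Mat2 N) {j k : ℕ} (hj : j + 1 < p) (hk : k < p)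
    (hjk : k < j) :
    Commute ((adjOp M p j hj).map (algebraMap ℂ B)) (barCopy F L p k hk) := by
  induction k with
  | zero =>
    change Commute _ (siteOp L ⟨0, hk⟩)
    unfold adjOp
    rw [siteOp_eq_place]
    refine commute_pairOp_place M (adj_ne hj) _ ?_ ?_ _ <;>
    · rw [range_siteEmb]
      simp [Fin.ext_iff]
      try omega
  | succ k ih =>
    rw [barCopy_succ]
    exact ((commute_adjOp_adjOp M F hj hk hjk).mul_right (ih _ (by omega))).mul_right
      (commute_adjOp_adjOp M F⁻¹ hj hk hjk)

/-- A copy beyond both positions of `R` is obtained by conjugations that include the two `R`'s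
overlapping it. The critical case is `k = j + 2`: the braid relation turns `r` into `s`, which
passes the inner copy and is turned back into `r` on the other side. -/
theorem IsHeckeSymmetry.commute_adjOp_barCopy (hR : IsHeckeSymmetry R q) {j k : ℕ}
    (hj : j + 1 < p) (hk : k < p) (hjk : j + 1 < k) :
    Commute ((adjOp R p j hj).map (algebraMap ℂ B)) (barCopy R L p k hk) := by
  induction k with
  | zero => omega
  | succ k ih =>
    rcases Nat.lt_or_ge (j + 1) k with h | h
    · rw [barCopy_succ]
      exact ((commute_adjOp_adjOp R R hk hj h).symm.mul_right (ih _ h)).mul_right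
        (commute_adjOp_adjOp R⁻¹ R hk hj h).symm
    · obtain rfl : k = j + 1 := by omega
      rw [barCopy_succ, barCopy_succ]
      set r := (adjOp R p j hj).map (algebraMap ℂ B) with hr
      set s := (adjOp R p (j + 1) hk).map (algebraMap ℂ B) with hs
      set r' := (adjOp R⁻¹ p j hj).map (algebraMap ℂ B)
      set s' := (adjOp R⁻¹ p (j + 1) hk).map (algebraMap ℂ B)
      set x := barCopy R L p j (Nat.lt_of_succ_lt hj)
      have hbr : s * r * s = r * s * r := by
        rw [hr, hs]
        simp only [← map_algebraMap_mul, braid_adjOp hR.braid hk]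
      have hsx : s * x = x * s := commute_adjOp_barCopy_of_lt L R R hk _ (Nat.lt_succ_self j)
      have hrr : r * r' = 1 := map_adjOp_mul_eq_one hR.mul_inv hj
      have hrr' : r' * r = 1 := map_adjOp_mul_eq_one hR.inv_mul hj
      have hss : s * s' = 1 := map_adjOp_mul_eq_one hR.mul_inv hk
      have hss' : s' * s = 1 := map_adjOp_mul_eq_one hR.inv_mul hk
      -- The braid relation in the form in which `s` is turned back into `r` after passing `x`.
      have h2 : s * (r' * s') = r' * s' * r := by
        calc s * (r' * s') = r' * s' * (s * r * s) * r' * s' := by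
              rw [show r' * s' * (s * r * s) * r' * s' = r' * (s' * s) * r * s * r' * s' by
                simp only [mul_assoc], hss', mul_one, hrr', one_mul, mul_assoc]
          _ = r' * s' * r * s * (r * r') * s' := by rw [hbr]; simp only [mul_assoc]
          _ = r' * s' * r := by rw [hrr, mul_one, mul_assoc _ s, hss, mul_one]
      change r * (s * (r * x * r') * s') = s * (r * x * r') * s' * r
      calc r * (s * (r * x * r') * s') = r * s * r * x * (r' * s') := by simp only [mul_assoc]
        _ = s * r * (s * x) * (r' * s') := by rw [← hbr]; simp only [mul_assoc]
        _ = s * r * x * (s * (r' * s')) := by rw [hsx]; simp only [mul_assoc]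
        _ = _ := by rw [h2]; simp only [mul_assoc]

end Copies

/-! ### Initial and final segments of ordered products -/

section SeqProd

variable {M : Type*} [Monoid M]

/-- The product `x_0 x_1 ⋯ x_{k-1}`. -/
def seqProd (x : ℕ → M) : ℕ → M
  | 0 => 1
  | k + 1 => seqProd x k * x k

theorem prod_ofFn_eq_seqProd (x : ℕ → M) (p : ℕ) :
    (List.ofFn fun k : Fin p => x k).prod = seqProd x p := by
  induction p with
  | zero => rfl
  | succ p ih =>
    rw [List.ofFn_succ', List.concat_eq_append, List.prod_append, List.prod_singleton]
    exact congrArg (· * x p) ih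

theorem seqProd_congr {x y : ℕ → M} {k : ℕ} (h : ∀ i < k, x i = y i) :
    seqProd x k = seqProd y k := by
  induction k with
  | zero => rfl
  | succ k ih =>
    rw [seqProd, seqProd, ih fun i hi => h i (by omega), h k (by omega)]

theorem map_seqProd {M' F : Type*} [Monoid M'] [FunLike F M M'] [MonoidHomClass F M M'] (φ : F)
    (x : ℕ → M) (k : ℕ) : φ (seqProd x k) = seqProd (fun i => φ (x i)) k := by
  induction k with
  | zero => exact map_one φ
  | succ k ih => rw [seqProd, seqProd, map_mul, ih]

theorem commute_seqProd {r : M} {x : ℕ → M} {k : ℕ} (h : ∀ i < k, Commute r (x i)) :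
    Commute r (seqProd x k) := by
  induction k with
  | zero => exact Commute.one_right r
  | succ k ih => exact (ih fun i hi => h i (by omega)).mul_right (h k (by omega))

/-- The product `x_{m-d} ⋯ x_{m-1}`. -/
def tailProd (x : ℕ → M) (m : ℕ) : ℕ → M
  | 0 => 1
  | d + 1 => x (m - (d + 1)) * tailProd x m d

theorem seqProd_mul_tailProd (x : ℕ → M) {m d : ℕ} (h : d ≤ m) :
    seqProd x (m - d) * tailProd x m d = seqProd x m := by
  induction d with
  | zero => exact mul_one _
  | succ d ih =>
    rw [tailProd, ← mul_assoc, ← ih (by omega)]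
    congr 1
    rw [show m - d = m - (d + 1) + 1 by omega]
    rfl

theorem tailProd_self (x : ℕ → M) (m : ℕ) : tailProd x m m = seqProd x m := by
  rw [← seqProd_mul_tailProd x le_rfl, Nat.sub_self]
  exact (one_mul _).symm

theorem commute_tailProd {r : M} {x : ℕ → M} {m d : ℕ} (hd : d ≤ m)
    (h : ∀ i, m - d ≤ i → i < m → Commute r (x i)) : Commute r (tailProd x m d) := by
  induction d with
  | zero => exact Commute.one_right r
  | succ d ih =>
    exact (h _ le_rfl (by omega)).mul_right (ih (by omega) fun i h1 h2 => h i (by omega) h2)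

end SeqProd

/-- On sequences in `k`, the recursion applies the sum of the shift and left multiplication by `c`.
These operators commute, so the binomial theorem for commuting endomorphisms applies to the powers
of the sum. -/
theorem binomial_recursion {B : Type*} [Ring B] (c : B) {m : ℕ} (G : ℕ → ℕ → B)
    (hG : ∀ d k, d + 1 + k ≤ m → G (d + 1) k = G d (k + 1) + c * G d k) (d k : ℕ)
    (h : d + k ≤ m) :
    G d k = ∑ j ∈ Finset.range (d + 1), c ^ (d - j) * ((d.choose j : B) * G 0 (k + j)) := by
  let E : Module.End ℕ (ℕ → B) :=
    { toFun := fun w k => w (k + 1), map_add' := fun _ _ => rfl, map_smul' := fun _ _ => rfl }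
  let T : Module.End ℕ (ℕ → B) :=
    { toFun := fun w k => c * w k
      map_add' := fun _ _ => funext fun _ => mul_add _ _ _
      map_smul' := fun n w => funext fun k =>
        (mul_smul_comm n c (w k) : c * (n • w k) = n • (c * w k)) }
  have hET : Commute E T := rfl
  have hE : ∀ j w k, (E ^ j) w k = w (k + j) := by
    intro j
    induction j with
    | zero => exact fun _ _ => rfl
    | succ j ih =>
      intro w k
      rw [pow_succ, Module.End.mul_apply, ih]
      rfl
  have hT : ∀ j w k, (T ^ j) w k = c ^ j * w k := by
    intro j
    induction j with
    | zero => exact fun _ _ => (by simp)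
    | succ j ih =>
      intro w k
      rw [pow_succ, Module.End.mul_apply, ih, pow_succ, mul_assoc]
      rfl
  have key : ∀ d k, d + k ≤ m → G d k = ((E + T) ^ d) (G 0) k := by
    intro d
    induction d with
    | zero => exact fun _ _ => rfl
    | succ d ih =>
      intro k hk
      rw [hG d k hk, ih k (by omega), ih (k + 1) (by omega), pow_succ', Module.End.mul_apply]
      rfl
  rw [key d k h, hET.add_pow, LinearMap.sum_apply, Finset.sum_apply]
  refine Finset.sum_congr rfl fun j _ => ?_
  have hc : ((d.choose j : ℕ) : Module.End ℕ (ℕ → B)) (G 0) = fun k => (d.choose j : B) * G 0 k := by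
    funext k
    rw [Module.End.natCast_apply, Pi.smul_apply, nsmul_eq_mul]
  rw [Module.End.mul_apply, Module.End.mul_apply, hE, hT, hc]

/-! ### Tracing against a numerical matrix -/

section Pairing

variable {N p : ℕ} {B : Type*} [Ring B] [Algebra ℂ B]

/-- The trace of `A X`, where the entries of `A` are numbers. -/
def pairing (A : TMat N p ℂ) (X : TMat N p B) : B := ∑ f, ∑ g, A g f • X f g

theorem pairing_map_mul (A Y : TMat N p ℂ) (X : TMat N p B) :
    pairing A (Y.map (algebraMap ℂ B) * X) = pairing (A * Y) X := by
  simp only [pairing, Matrix.mul_apply, Matrix.map_apply, Finset.smul_sum, Finset.sum_smul,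
    mul_smul, ← Algebra.smul_def]
  exact (sum_rotate _).trans (Finset.sum_congr rfl fun _ _ => Finset.sum_comm)

theorem pairing_mul_map (A Y : TMat N p ℂ) (X : TMat N p B) :
    pairing A (X * Y.map (algebraMap ℂ B)) = pairing (Y * A) X := by
  simp only [pairing, Matrix.mul_apply, Matrix.map_apply, Finset.smul_sum, Finset.sum_smul,
    ← Algebra.commutes, ← Algebra.smul_def]
  refine Finset.sum_congr rfl fun f _ => ?_
  rw [Finset.sum_comm]
  exact Finset.sum_congr rfl fun g _ => Finset.sum_congr rfl fun h _ => by
    rw [smul_smul, mul_comm]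

theorem pairing_sub (A : TMat N p ℂ) (X Y : TMat N p B) :
    pairing A (X - Y) = pairing A X - pairing A Y := by
  simp [pairing, smul_sub]

theorem pairing_scalar_mul (A : TMat N p ℂ) (c : B) (X : TMat N p B) :
    pairing A (Matrix.scalar (Fin p → Fin N) c * X) = c * pairing A X := by
  simp [pairing, Matrix.scalar_apply, Matrix.diagonal_mul, Finset.mul_sum]

theorem pairing_smul (s : ℂ) (A : TMat N p ℂ) (X : TMat N p B) :
    pairing (s • A) X = s • pairing A X := by
  simp [pairing, Finset.smul_sum, mul_smul]

theorem pairing_map {B' : Type*} [Ring B'] [Algebra ℂ B'] (φ : B →ₐ[ℂ] B') (A : TMat N p ℂ)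
    (X : TMat N p B) : pairing A (X.map φ) = φ (pairing A X) := by
  simp [pairing]

theorem multiTrace_eq_pairing (C : Matrix (Fin N) (Fin N) ℂ) (X : TMat N p B) :
    multiTrace C X = pairing (tensorPow C p) X := by
  unfold multiTrace pairing tensorPow
  exact Finset.sum_comm

theorem qDet_eq_pairing {F : Mat2 N} {u v : (Fin p → Fin N) → ℂ} {A : TMat N p ℂ}
    (hA : ∀ f g, A f g = u f * v g) (L : Matrix (Fin N) (Fin N) B) :
    qDet F u v L = pairing A (barProd F L p) := by
  simp only [qDet, pairing, hA, mul_comm]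

end Pairing

/-! ### Binomial expansion of the determinant -/

section Bracket

variable {N m : ℕ} {B : Type*} [Ring B] [Algebra ℂ B] {R : Mat2 N} {q : ℂ}
  (L : Matrix (Fin N) (Fin N) B)

/-- `L_{\bar 1}, L_{\bar 2}, …`, continued by the identity. -/
def barSeq (F : Mat2 N) (L : Matrix (Fin N) (Fin N) B) (p k : ℕ) : TMat N p B :=
  if h : k < p then barCopy F L p k h else 1

theorem barSeq_of_lt (F : Mat2 N) {p k : ℕ} (h : k < p) :
    barSeq F L p k = barCopy F L p k h := dif_pos h

theorem barProd_eq_seqProd (F : Mat2 N) (p : ℕ) : barProd F L p = seqProd (barSeq F L p) p := by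
  rw [← prod_ofFn_eq_seqProd]
  unfold barProd
  congr 2
  funext k
  rw [barSeq_of_lt L F k.isLt]

/-- Numerical matrices move cyclically under the trace, and `A^{(m)}` picks up the same scalar
`-q⁻¹` from `R` on either side, so `R⁻¹ A R = A`. -/
theorem IsHeckeSymmetry.pairing_conj (hR : IsHeckeSymmetry R q) {j : ℕ} (h : j + 1 < m)
    (X : TMat N m B) :
    pairing (skewSymmetrizer R q m) ((adjOp R m j h).map (algebraMap ℂ B) * X *
      (adjOp R⁻¹ m j h).map (algebraMap ℂ B)) = pairing (skewSymmetrizer R q m) X := by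
  rw [pairing_mul_map, pairing_map_mul, mul_assoc, hR.skewSymmetrizer_mul_adjOp,
    ← hR.adjOp_mul_skewSymmetrizer h, ← mul_assoc, adjOp_mul_eq_one hR.inv_mul, one_mul]

/-- One step writes the copy numbered `i + 1` as a conjugate of the copy numbered `i`. The
conjugating `R` commutes with the first `k ≤ i` copies and with `Y`, so the conjugation extends to
the whole product and disappears under the pairing. -/
theorem IsHeckeSymmetry.pairing_shift (hR : IsHeckeSymmetry R q) {k i : ℕ} (hki : k ≤ i)
    (hi : i < m) (Y : TMat N m B)
    (hY : ∀ j (h : j + 1 < m), j < i →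
      Commute ((adjOp R m j h).map (algebraMap ℂ B)) Y) :
    pairing (skewSymmetrizer R q m) (seqProd (barSeq R L m) k * barSeq R L m i * Y) =
      pairing (skewSymmetrizer R q m) (seqProd (barSeq R L m) k * barSeq R L m k * Y) := by
  induction i, hki using Nat.le_induction with
  | base => rfl
  | succ i hki ih =>
    rw [← ih (by omega) fun j h hj => hY j h (by omega),
      ← hR.pairing_conj hi (seqProd (barSeq R L m) k * barSeq R L m i * Y)]
    rw [barSeq_of_lt L R hi, barSeq_of_lt L R (Nat.lt_of_succ_lt hi), barCopy_succ]
    have hYr := hY i hi (Nat.lt_succ_self i)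
    have hYr' : Commute ((adjOp R⁻¹ m i hi).map (algebraMap ℂ B)) Y := by
      have h1 := map_adjOp_mul_eq_one (B := B) hR.mul_inv hi
      have h2 := map_adjOp_mul_eq_one (B := B) hR.inv_mul hi
      calc _ = (adjOp R⁻¹ m i hi).map (algebraMap ℂ B) * (Y *
            (adjOp R m i hi).map (algebraMap ℂ B)) *
              (adjOp R⁻¹ m i hi).map (algebraMap ℂ B) := by
            rw [mul_assoc, mul_assoc, h1, mul_one]
        _ = _ := by rw [← hYr.eq, ← mul_assoc, h2, one_mul]
    have hP : Commute ((adjOp R m i hi).map (algebraMap ℂ B)) (seqProd (barSeq R L m) k) :=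
      commute_seqProd fun j hj => by
        rw [barSeq_of_lt L R (show j < m by omega)]
        exact commute_adjOp_barCopy_of_lt L R R hi _ (by omega)
    congr 1
    simp only [← mul_assoc]
    rw [hP.eq]
    simp only [mul_assoc]
    rw [hYr'.eq]

theorem IsHeckeSymmetry.pairing_barProd_sub (hR : IsHeckeSymmetry R q) (c : B)
    (hc : ∀ b, Commute c b) :
    pairing (skewSymmetrizer R q m) (barProd R (L - Matrix.scalar (Fin N) c) m) =
      ∑ k ∈ Finset.range (m + 1), (-c) ^ (m - k) *
        ((m.choose k : B) * pairing (skewSymmetrizer R q m) (seqProd (barSeq R L m) k)) := by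
  set x := barSeq R L m
  set y := barSeq R (L - Matrix.scalar (Fin N) c) m with hy
  have hxy : ∀ i < m, y i = x i - Matrix.scalar (Fin m → Fin N) c := fun i hi => by
    rw [hy, barSeq_of_lt _ _ hi, barCopy_sub_scalar L hR.mul_inv c hc, ← barSeq_of_lt]
  have hsc : ∀ X : TMat N m B, Commute X (Matrix.scalar (Fin m → Fin N) c) := fun X =>
    (Matrix.scalar_commute c hc X).symm
  -- `G d k` holds the first `k` copies of `L` followed by the last `d` copies of `L - c`; `G m 0`
  -- is the determinant and `G 0 k` the pure trace.
  have key := binomial_recursion (-c) (m := m)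
    (fun d k => pairing (skewSymmetrizer R q m) (seqProd x k * tailProd y m d)) ?_ m 0 le_rfl
  · rw [barProd_eq_seqProd]
    change pairing _ (seqProd y m) = _
    rw [← tailProd_self]
    simpa [seqProd, tailProd] using key
  · intro d k hdk
    -- The tail starts at `m - d`, while lowering the factor at `m - (d + 1)` uses only `R` with `j
    -- + 1 < m - d`, so these commute with every tail factor.
    have hshift := hR.pairing_shift L (k := k) (i := m - (d + 1)) (by omega) (by omega)
      (tailProd y m d) fun j h hj => commute_tailProd (by omega) fun i h1 h2 => by
        rw [hxy i h2]
        refine Commute.sub_right ?_ (hsc _)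
        change Commute _ (barSeq R L m i)
        rw [barSeq_of_lt L R h2]
        exact hR.commute_adjOp_barCopy L h h2 (by omega)
    change _ = pairing _ (seqProd x k * x k * tailProd y m d) + _
    rw [← hshift]
    change pairing _ (seqProd x k * (y (m - (d + 1)) * tailProd y m d)) = _
    rw [hxy _ (by omega), sub_mul, mul_sub, pairing_sub, ← mul_assoc, ← mul_assoc, (hsc _).eq,
      mul_assoc (Matrix.scalar _ c), pairing_scalar_mul, neg_mul, sub_eq_add_neg]

end Bracket

/-! ### From traces against `A^{(m)}` to the elementary symmetric polynomials -/

section Trace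

variable {N m : ℕ} {R Ψ : Mat2 N} {q : ℂ}

theorem IsDetPair.skewSymmetrizer_ne_zero {u v : (Fin m → Fin N) → ℂ}
    (huv : IsDetPair R q m u v) : skewSymmetrizer R q m ≠ 0 := by
  intro h
  refine one_ne_zero (α := ℂ) ?_
  rw [← huv.2]
  refine Finset.sum_eq_zero fun f _ => ?_
  rw [mul_comm, ← huv.1, h, Matrix.zero_apply]

theorem trace_traceMatrix (hR : IsHeckeSymmetry R q) (hΨ : IsSkewInverse R Ψ)
    (h0 : skewSymmetrizer R q m ≠ 0) (h1 : skewSymmetrizer R q (m + 1) = 0) :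
    (traceMatrix Ψ).trace = (q ^ m)⁻¹ * qInt q (m : ℤ) := by
  have h := ptrace_skewSymmetrizer hR hΨ m
  have hz : ptrace (traceMatrix Ψ) (0 : TMat N (m + 1) ℂ) = 0 := by
    ext; simp [ptrace]
  rw [h1, hz] at h
  have h2 := (smul_eq_zero.1 h.symm).resolve_right h0
  rw [div_eq_zero_iff, or_iff_left (hR.qInt_ne_zero (Nat.succ_ne_zero m)), sub_eq_zero] at h2
  rw [← h2, inv_mul_cancel_left₀ (pow_ne_zero _ hR.q_ne_zero)]

/-- The factor by which the partial trace reduces `A^{(k+1)}` to `A^{(k)}`. -/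
def traceFactor (q : ℂ) (m k : ℕ) : ℂ :=
  (q ^ m)⁻¹ * qInt q ((m - k : ℕ) : ℤ) / qInt q ((k + 1 : ℕ) : ℤ)

theorem ptrace_skewSymmetrizer_of_even (hR : IsHeckeSymmetry R q) (hΨ : IsSkewInverse R Ψ)
    (htr : (traceMatrix Ψ).trace = (q ^ m)⁻¹ * qInt q (m : ℤ)) {k : ℕ} (hk : k ≤ m) :
    ptrace (traceMatrix Ψ) (skewSymmetrizer R q (k + 1)) =
      traceFactor q m k • skewSymmetrizer R q k := by
  rw [ptrace_skewSymmetrizer hR hΨ, htr, qInt_sub_left hR.q_ne_zero hk]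
  rfl

variable {B : Type*} [Ring B] [Algebra ℂ B] (L : Matrix (Fin N) (Fin N) B)

theorem place_seqProd_barSeq (F : Mat2 N) {p k : ℕ} (h : k ≤ p) :
    place Fin.castSuccEmb (seqProd (barSeq F L p) k) = seqProd (barSeq F L (p + 1)) k := by
  induction k with
  | zero => exact place_one _
  | succ k ih =>
    rw [seqProd, seqProd, place_mul, ih (by omega), barSeq_of_lt L F (show k < p by omega),
      barSeq_of_lt L F (show k < p + 1 by omega), place_barCopy]

theorem elemSym_eq (F : Mat2 N) (C : Matrix (Fin N) (Fin N) ℂ) (k : ℕ) :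
    elemSym R F q C L k = multiTrace C
      ((skewSymmetrizer R q k).map (algebraMap ℂ B) * seqProd (barSeq F L k) k) := by
  rw [← barProd_eq_seqProd]
  cases k with
  | zero =>
    simp [elemSym, multiTrace, skewSymmetrizer, barProd]
  | succ k => rfl

theorem multiTrace_smul {p : ℕ} (C : Matrix (Fin N) (Fin N) ℂ) (s : ℂ) (X : TMat N p B) :
    multiTrace C (s • X) = s • multiTrace C X := by
  simp only [multiTrace, Matrix.smul_apply, Finset.smul_sum, smul_comm s]

/-- Positions after the first `k` meet only the skew-symmetrizer and are traced out one by one, each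
giving a `traceFactor`. Keeping both products of factors avoids division. -/
theorem multiTrace_skewSymmetrizer (hR : IsHeckeSymmetry R q) (hΨ : IsSkewInverse R Ψ)
    (htr : (traceMatrix Ψ).trace = (q ^ m)⁻¹ * qInt q (m : ℤ)) {k p : ℕ} (hkp : k ≤ p)
    (hp : p ≤ m) :
    (∏ j ∈ Finset.range k, traceFactor q m j) • multiTrace (traceMatrix Ψ)
      ((skewSymmetrizer R q p).map (algebraMap ℂ B) * seqProd (barSeq R L p) k) =
    (∏ j ∈ Finset.range p, traceFactor q m j) •
      elemSym R R q (traceMatrix Ψ) L k := by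
  induction p, hkp using Nat.le_induction with
  | base => rw [elemSym_eq]
  | succ p hkp ih =>
    have hmap : (traceFactor q m p • skewSymmetrizer R q p).map (algebraMap ℂ B) =
        traceFactor q m p • (skewSymmetrizer R q p).map (algebraMap ℂ B) := by
      ext
      simp only [Matrix.map_apply, Matrix.smul_apply, smul_eq_mul, map_mul,
        Algebra.smul_def (A := B)]
    rw [← place_seqProd_barSeq L R hkp, ← multiTrace_ptrace, ptrace_mul_place, ptrace_map,
      ptrace_skewSymmetrizer_of_even hR hΨ htr (by omega), hmap, smul_mul_assoc, multiTrace_smul,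
      smul_comm, ih (by omega), Finset.prod_range_succ, smul_smul, mul_comm]

/-- Idempotency and commutation give `C^{⊗m} A = A C^{⊗m} A`, and sandwiching by the rank-one matrix
`A = |u⟩⟨v|` yields a multiple of `A`. -/
theorem tensorPow_mul_skewSymmetrizer (hR : IsHeckeSymmetry R q) (hΨ : IsSkewInverse R Ψ)
    {u v : (Fin m → Fin N) → ℂ} (huv : IsDetPair R q m u v) :
    ∃ κ : ℂ, tensorPow (traceMatrix Ψ) m * skewSymmetrizer R q m = κ • skewSymmetrizer R q m := by
  refine ⟨∑ g, ∑ h, v h * tensorPow (traceMatrix Ψ) m h g * u g, ?_⟩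
  nth_rewrite 1 [← hR.skewSymmetrizer_idem]
  rw [← mul_assoc, (hΨ.commute_tensorPow hR m).eq]
  ext f f'
  simp only [Matrix.mul_apply, huv.1, Matrix.smul_apply, smul_eq_mul, Finset.sum_mul]
  exact Finset.sum_congr rfl fun g _ => Finset.sum_congr rfl fun h _ => by ring

theorem traceFactor_ne_zero (hR : IsHeckeSymmetry R q) {k : ℕ} (hk : k < m) :
    traceFactor q m k ≠ 0 :=
  div_ne_zero (mul_ne_zero (inv_ne_zero (pow_ne_zero _ hR.q_ne_zero))
    (hR.qInt_ne_zero (by omega))) (hR.qInt_ne_zero (by omega))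

theorem pairing_seqProd_eq (hR : IsHeckeSymmetry R q) (hΨ : IsSkewInverse R Ψ)
    (htr : (traceMatrix Ψ).trace = (q ^ m)⁻¹ * qInt q (m : ℤ))
    {u v : (Fin m → Fin N) → ℂ} (huv : IsDetPair R q m u v) {k : ℕ} (hk : k ≤ m) :
    (∏ j ∈ Finset.range k, traceFactor q m j) •
      pairing (skewSymmetrizer R q m) (seqProd (barSeq R L m) k) =
    elemSym R R q (traceMatrix Ψ) L k := by
  obtain ⟨κ, hκ⟩ := tensorPow_mul_skewSymmetrizer hR hΨ huv
  have hm : ∏ j ∈ Finset.range m, traceFactor q m j ≠ 0 :=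
    Finset.prod_ne_zero_iff.2 fun j hj => traceFactor_ne_zero hR (Finset.mem_range.1 hj)
  -- The case `k = 0` determines `κ`, since `A^{(m)}` has ordinary trace `⟨v, u⟩ = 1`. No copy of
  -- `L` enters, so the zero matrix over `ℂ` serves.
  have hκm : κ = ∏ j ∈ Finset.range m, traceFactor q m j := by
    have h := multiTrace_skewSymmetrizer (0 : Matrix (Fin N) (Fin N) ℂ) hR hΨ htr
      (Nat.zero_le m) le_rfl
    rw [multiTrace_eq_pairing, pairing_map_mul, hκ, pairing_smul] at h
    have h1 : pairing (skewSymmetrizer R q m) (1 : TMat N m ℂ) = 1 := by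
      rw [← huv.2]
      simp [pairing, Matrix.one_apply, huv.1, mul_comm]
    simpa [seqProd, h1, elemSym] using h
  have h := multiTrace_skewSymmetrizer L hR hΨ htr hk le_rfl
  rw [multiTrace_eq_pairing, pairing_map_mul, hκ, pairing_smul, hκm, smul_comm] at h
  exact smul_right_injective B hm h

theorem qFact_succ (q : ℂ) (k : ℕ) : qFact q (k + 1) = qFact q k * qInt q ((k + 1 : ℕ) : ℤ) := by
  unfold qFact
  rw [Finset.prod_Icc_succ_top (by omega)]

theorem qFact_ne_zero (hR : IsHeckeSymmetry R q) (k : ℕ) : qFact q k ≠ 0 :=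
  Finset.prod_ne_zero_iff.2 fun j hj => hR.qInt_ne_zero (by
    have := (Finset.mem_Icc.1 hj).1
    omega)

/-- The numerators `(m-j)_q` for `j < k` multiply to `m_q! / (m-k)_q!`, the denominators to `k_q!`,
and the powers of `q` to `q^{-mk}`. -/
theorem prod_traceFactor (hR : IsHeckeSymmetry R q) {k : ℕ} (hk : k ≤ m) :
    (∏ j ∈ Finset.range k, traceFactor q m j) * (q ^ (m * k) * (qFact q k * qFact q (m - k))) =
      qFact q m := by
  induction k with
  | zero => simp [qFact]
  | succ k ih =>
    have h1 : qFact q (m - k) = qFact q (m - (k + 1)) * qInt q ((m - k : ℕ) : ℤ) := by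
      rw [show m - k = m - (k + 1) + 1 by omega, qFact_succ]
    rw [← ih (by omega), Finset.prod_range_succ, qFact_succ, h1, traceFactor, mul_add, pow_add,
      mul_one]
    have hq := pow_ne_zero m hR.q_ne_zero
    have hk1 : qInt q ((k + 1 : ℕ) : ℤ) ≠ 0 := hR.qInt_ne_zero (Nat.succ_ne_zero k)
    field_simp

theorem alphaCoeff_mul (hR : IsHeckeSymmetry R q) {k : ℕ} (hk : k ≤ m) :
    alphaCoeff q m k * ∏ j ∈ Finset.range k, traceFactor q m j = m.choose k := by
  have h := prod_traceFactor hR hk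
  have hm := qFact_ne_zero hR m
  unfold alphaCoeff
  rw [mul_div_assoc', div_mul_eq_mul_div, div_eq_iff hm, ← h]
  ring

end Trace

/-- The entries of `L` are never permuted: only numerical matrices are moved. Hence the identity can
be stated for a matrix over any algebra and then applied to the generating matrix. -/
theorem qDet_sub_X {N m : ℕ} {B : Type*} [Ring B] [Algebra ℂ B] {q : ℂ} {R Ψ : Mat2 N}
    (hR : IsHeckeSymmetry R q) (heven : IsEven R q m) (hΨ : IsSkewInverse R Ψ)
    {u v : (Fin m → Fin N) → ℂ} (huv : IsDetPair R q m u v) (L : Matrix (Fin N) (Fin N) B) :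
    qDet R u v (L.map Polynomial.C - Matrix.scalar (Fin N) (Polynomial.X : Polynomial B)) =
      ∑ k ∈ Finset.range (m + 1), (-Polynomial.X) ^ (m - k) *
        Polynomial.C (alphaCoeff q m k • elemSym R R q (traceMatrix Ψ) L k) := by
  have htr := trace_traceMatrix hR hΨ huv.skewSymmetrizer_ne_zero
    (skewSymmetrizer_eq_zero hR (heven.2 (m + 1) (Nat.lt_succ_self m)))
  rw [qDet_eq_pairing huv.1, hR.pairing_barProd_sub _ _ fun b => Polynomial.commute_X b]
  refine Finset.sum_congr rfl fun k hk => ?_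
  have hkm : k ≤ m := Nat.lt_succ_iff.1 (Finset.mem_range.1 hk)
  congr 1
  -- The first `k` copies contain no `t`, so their trace is a constant polynomial.
  have hmap : seqProd (barSeq R (L.map (Polynomial.C : B →+* Polynomial B)) m) k =
      (seqProd (barSeq R L m) k).map (Polynomial.CAlgHom (R := ℂ) (A := B)) := by
    refine Eq.trans ?_ (map_seqProd (Polynomial.CAlgHom (R := ℂ) (A := B)).mapMatrix _ _).symm
    refine seqProd_congr fun i hi => ?_
    rw [barSeq_of_lt _ _ (by omega), AlgHom.mapMatrix_apply, barSeq_of_lt _ _ (by omega),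
      ← barCopy_map]
    rfl
  rw [hmap, pairing_map, ← pairing_seqProd_eq L hR hΨ htr huv hkm, smul_smul,
    alphaCoeff_mul hR hkm, Polynomial.CAlgHom_apply,
    Nat.cast_smul_eq_nsmul, nsmul_eq_mul, map_mul, map_natCast]

end QuantumDet

end

theorem mainTheorem1 {N m : ℕ} (q : ℂ) (R Ψ : QuantumDet.Mat2 N)
    (hR : QuantumDet.IsHeckeSymmetry R q) (heven : QuantumDet.IsEven R q m)
    (hΨ : QuantumDet.IsSkewInverse R Ψ)
    (u v : (Fin m → Fin N) → ℂ) (huv : QuantumDet.IsDetPair R q m u v) :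
    QuantumDet.qDet R u v
        ((QuantumDet.genL R R).map Polynomial.C -
          Matrix.scalar (Fin N) (Polynomial.X : Polynomial (QuantumDet.QMA R R))) =
      ∑ k ∈ Finset.range (m + 1), (-Polynomial.X) ^ (m - k) *
        Polynomial.C (QuantumDet.alphaCoeff q m k •
          QuantumDet.elemSym R R q (QuantumDet.traceMatrix Ψ) (QuantumDet.genL R R) k) :=
  QuantumDet.qDet_sub_X hR heven hΨ huv _
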